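/- For every integer $k\ge 0$ and every real $\varepsilon>0$ there are constants $C,c>0$, depending only on $k$ and $\varepsilon$, such that the following holds for all $n\ge 0$, $L\ge 1$ and every quantum circuit of $L$ unitary gates $U_1,\dots,U_L$ on $n$ qubits, each acting on at most $k$ qubits. Put $|\psi_j\rangle=U_j\cdots U_1|0\rangle^{\otimes n}$ for $0\le j\le L$ and $|\psi_j\rangle=|\psi_L\rangle$ for $j>L$; $|\psi_L\rangle$ is the output of the circuit. There are integers $m,s\ge 0$ with $m\le C\ln(L+1)$ and $s+L<2^m$, a Hamiltonian $\mathcal H$ with real coefficients in the Pauli basis, acting on $n+m$ qubits ($n$ data qubits and $m$ clock qubits, whose basis states are $|t\rangle$, $0\le t<2^m$), and real numbers $\delta\le\Delta$ such that: 1. $\mathcal H$ has at most $C(L^2+n)$ nonzero coefficients in the Pauli basis (in particular $O(L^2)$ of them when $n=O(L^2)$, e.g. when every qubit is acted on by some gate). 2. The lowest eigenvalue of $\mathcal H$ is $0$, all its eigenvalues are at most $C(n+1)$, and its ground state is non-degenerate, spanned by the history state of the circuit padded with $s$ identity gates at its start and with $2^m-1-s-L$ identity gates at its end, $$|\psi_{\rm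 hist}\rangle=2^{-m/2}\sum_{t=0}^{2^m-1}|\psi_{\max(t-s,0)}\rangle\otimes|t\rangle .$$ 3. $\Delta$ is the spectral gap of $\mathcal H$, and $c\,L^{-2}\le\delta\le\Delta$. 4. Every unit vector $\phi$ with $\langle\phi|\mathcal H|\phi\rangle<\Delta$ satisfies $|\langle\psi_{\rm hist}|\phi\rangle|^2\ge 1-\langle\phi|\mathcal H|\phi\rangle/\Delta$. 5. Acceptance implies preparation of the output: every unit vector $\phi$ with $\langle\phi|\mathcal H|\phi\rangle<\delta$ satisfies $\langle\psi_L|\,\mathrm{Tr}_{\rm clock}(|\phi\rangle\langle\phi|)\,|\psi_L\rangle\ge 1-\varepsilon$. 6. The gate sequence gives a variational sequence that is accepted: for $\theta\in\mathbb R^m$ let $|\psi(\theta)\rangle$ be the state obtained from $|0\rangle^{\otimes(n+m)}$ by rotating the $i$-th clock qubit by $e^{-\mathrm i\theta_iY}$ for each $i$ and then applying, for $l=1,\dots,L$ in this order, the gate $U_l$ to the data qubits controlled on the clock showing a time $t\ge s+l$. There is a $\theta$ with $|\psi(\theta)\rangle=|\psi_{\rm hist}\rangle$, and this state satisfies $\langle\psi(\theta)|\mathcal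 H|\psi(\theta)\rangle<\delta$. -/

import Mathlib

namespace VQC

noncomputable section

/-- Pure-state vectors of a register whose qubits are labelled by `q`, in the computational
basis `q → Fin 2`. -/
abbrev Ket (q : Type) : Type := (q → Fin 2) → ℂ

/-- Operators on the register `q`, in the computational basis. -/
abbrev Op (q : Type) : Type := Matrix (q → Fin 2) (q → Fin 2) ℂ

/-- The Pauli matrices `σ₀ = 1`, `σ₁ = X`, `σ₂ = Y`, `σ₃ = Z`. -/
def pauli : Fin 4 → Matrix (Fin 2) (Fin 2) ℂ :=
  ![1, !![0, 1; 1, 0], !![0, -Complex.I; Complex.I, 0], !![1, 0; 0, -1]]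

section Register

variable {q : Type} [Fintype q] [DecidableEq q]

/-- The Pauli string `⨂ i, σ_{α i}`. -/
def pauliString (α : q → Fin 4) : Op q :=
  fun x y => ∏ i, pauli (α i) (x i) (y i)

/-- The Hamiltonian with real coefficients `J` in the Pauli basis. -/
def hamiltonian (J : (q → Fin 4) → ℝ) : Op q :=
  ∑ α, (J α : ℂ) • pauliString α

/-- The number of Pauli strings that occur with a nonzero coefficient. -/
def cardinality (J : (q → Fin 4) → ℝ) : ℕ := {α | J α ≠ 0}.ncard

/-- Unit vectors. -/
def IsState (φ : Ket q) : Prop := star φ ⬝ᵥ φ = 1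

/-- The expected value `⟨φ|H|φ⟩` (a real number when `H` is Hermitian). -/
def energy (H : Op q) (φ : Ket q) : ℝ := (star φ ⬝ᵥ H.mulVec φ).re

/-- The objective function `φ ↦ ⟨φ|H|φ⟩` accepts `φ` at the threshold `δ`. -/
def Accepts (H : Op q) (δ : ℝ) (φ : Ket q) : Prop := energy H φ < δ

/-- The real eigenvalues of `H` (all of its eigenvalues when `H` is Hermitian). -/
def energyLevels (H : Op q) : Set ℝ :=
  {e | Module.End.HasEigenvalue (Matrix.toLin' H) (e : ℂ)}

/-- `e` is the lowest energy of `H` and it is attained by the state `ψ` only, up to scalars. -/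
def IsNondegenerateGroundState (H : Op q) (e : ℝ) (ψ : Ket q) : Prop :=
  IsLeast (energyLevels H) e ∧ IsState ψ ∧
    Module.End.eigenspace (Matrix.toLin' H) (e : ℂ) = Submodule.span ℂ {ψ}

/-- `Δ` is the difference between the two lowest distinct energies of `H`. -/
def IsSpectralGap (H : Op q) (Δ : ℝ) : Prop :=
  ∃ e₀ e₁ : ℝ, IsLeast (energyLevels H) e₀ ∧ IsLeast (energyLevels H \ {e₀}) e₁ ∧ Δ = e₁ - e₀

/-- The product state `|0…0⟩`. -/
def ketZero : Ket q := Pi.single (fun _ => 0) 1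

/-- The state prepared from `|0…0⟩` by a sequence of operators, the head of the list being
applied first. -/
def prepare (ops : List (Op q)) : Ket q :=
  ops.foldl (fun v M => M.mulVec v) ketZero

/-- The rotation `exp (-i θ Y)` of the qubit `i`. -/
def rotation (i : q) (θ : ℝ) : Op q := fun x y =>
  if ∀ j, j ≠ i → x j = y j then
    (!![(Real.cos θ : ℂ), -(Real.sin θ : ℂ); (Real.sin θ : ℂ), (Real.cos θ : ℂ)] :
      Matrix (Fin 2) (Fin 2) ℂ) (x i) (y i)
  else 0

/-- The variational statespace of a state preparation process with `p` real parameters. -/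
def variationalStatespace {p : ℕ} (ψ : (Fin p → ℝ) → Ket q) : Set (Ket q) := Set.range ψ

end Register

/-- A `k`-local gate on the register `q`: a unitary acting on a set of at most `k` qubits. -/
structure Gate (q : Type) [Fintype q] [DecidableEq q] (k : ℕ) where
  support : Finset q
  card_le : support.card ≤ k
  unitary : Matrix.unitaryGroup (support → Fin 2) ℂ

/-- The gate as an operator on the whole register, the identity outside its support. -/
def Gate.toOp {q : Type} [Fintype q] [DecidableEq q] {k : ℕ} (U : Gate q k) : Op q :=
  fun x y =>
    if ∀ i, i ∉ U.support → x i = y i then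
      (U.unitary : Matrix (U.support → Fin 2) (U.support → Fin 2) ℂ)
        (fun i => x i) (fun i => y i)
    else 0

section Circuit

variable {n k L : ℕ}

/-- The state `U_j ⋯ U_1 |0…0⟩` after the first `j` gates; for `j ≥ L` this is the output. -/
def stateAfter (U : Fin L → Gate (Fin n) k) (j : ℕ) : Ket (Fin n) :=
  prepare ((List.ofFn fun l => (U l).toOp).take j)

/-- The output `U_L ⋯ U_1 |0…0⟩` of the circuit. -/
def output (U : Fin L → Gate (Fin n) k) : Ket (Fin n) :=
  prepare (List.ofFn fun l => (U l).toOp)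

/-- The time in `{0, …, 2 ^ m - 1}` that is written in binary on a register of `m` qubits. -/
def clockTime {m : ℕ} (c : Fin m → Fin 2) : ℕ := ∑ i, (c i : ℕ) * 2 ^ (i : ℕ)

/-- The history state, with a clock of `m` qubits, of the circuit padded with `s` identity gates
at its start and with identity gates at its end, up to `2 ^ m - 1` gates in all:
`2 ^ (-m / 2) ∑ t, U_{t - s} ⋯ U_1 |0…0⟩ ⊗ |t⟩`. -/
def historyState (U : Fin L → Gate (Fin n) k) (m s : ℕ) : Ket (Fin n ⊕ Fin m) := fun z =>
  ((1 / Real.sqrt (2 ^ m) : ℝ) : ℂ) *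
    stateAfter U (clockTime (fun i => z (Sum.inr i)) - s) (fun i => z (Sum.inl i))

/-- The operator `A` on the data qubits, applied if the clock shows a time later than `r`. -/
def clockControlled {m : ℕ} (r : ℕ) (A : Op (Fin n)) : Op (Fin n ⊕ Fin m) := fun z w =>
  if ∀ i, z (Sum.inr i) = w (Sum.inr i) then
    if r < clockTime (fun i => z (Sum.inr i)) then
      A (fun i => z (Sum.inl i)) (fun i => w (Sum.inl i))
    else (1 : Op (Fin n)) (fun i => z (Sum.inl i)) (fun i => w (Sum.inl i))
  else 0

/-- The variational circuit built from the gate sequence: every clock qubit is rotated by its own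
tunable angle, then the gates `U_1, …, U_L` are applied in this order, the gate `U_l` under the
control of the clock showing a time at least `s + l` (`l = 1, …, L`). -/
def ansatz (U : Fin L → Gate (Fin n) k) (m s : ℕ) (θ : Fin m → ℝ) : Ket (Fin n ⊕ Fin m) :=
  prepare ((List.ofFn fun i : Fin m => rotation (Sum.inr i) (θ i)) ++
    (List.ofFn fun l : Fin L => clockControlled (s + l) (U l).toOp))

/-- The fidelity `⟨χ| Tr_clock |φ⟩⟨φ| |χ⟩` of the data register of `φ` with the state `χ`; it is
also the largest value of `|⟨χ ⊗ g|φ⟩|²` over the states `g` of the clock. -/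
def dataFidelity {m : ℕ} (χ : Ket (Fin n)) (φ : Ket (Fin n ⊕ Fin m)) : ℝ :=
  ∑ c : Fin m → Fin 2, ‖∑ x : Fin n → Fin 2, star (χ x) * φ (Sum.elim x c)‖ ^ 2

end Circuit

end

end VQC

namespace VQC

open Matrix

/-! This is the Feynman–Kitaev circuit-to-Hamiltonian construction with a binary clock of `N = 2 ^
m` times, `N` of order `L`, and no padding at the start (`s = 0`).

`historyHamiltonian` is a sum of positive terms `Bᴴ * B`. The propagation terms penalise a data
register at time `t + 1` that differs from the gate applied to the one at time `t`; the checks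
penalise input qubits that are not `0`. The history state is annihilated by every term.

For the gap, undo the first `t` gates in the slice at time `t` (`rotatedSlice`). The energy then
splits over the basis strings `x` of the data register into path Dirichlet energies plus check
terms. For `x = 0` the Poincaré inequality `variance_le_path` applies, and the subtracted mean is
exactly the overlap with the history state. For `x ≠ 0` some check pins the path at time zero or at
all times, and `sum_norm_sq_le_path` or the check itself bounds the whole norm. Together these give
the gap `1 / (4 * N ^ 2)` in `energy_historyHamiltonian_ge`; `exists_isSpectralGap` turns it into
the spectral gap and the stability bound.

The Pauli count rests on two savings. A matrix unit on the clock uses `2 ^ m` strings, not `4 ^ m`,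
so the `L` gates and the at most `L * k` touched qubits cost `O(L ^ 2)`. A qubit without gates is
checked at all times at once, which costs two strings instead of order `2 ^ m`.

For acceptance, the clock is so long that the history state already holds the output at all but a
fraction `ε / 4` of the times, and the threshold is a fraction at most `ε / 4` of the gap
(`dataFidelity_output_ge`). For the ansatz, rotations by `π / 4` make the clock uniform and the
controlled gates then write the history. -/

/-- The squared norm of a vector of amplitudes. -/
noncomputable def ketNormSq {ι : Type} [Fintype ι] (φ : ι → ℂ) : ℝ := ∑ z, ‖φ z‖ ^ 2

/-! ### Squared norms of amplitude vectors -/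

section NormSq

variable {ι : Type} [Fintype ι]

theorem ketNormSq_nonneg (φ : ι → ℂ) : 0 ≤ ketNormSq φ :=
  Finset.sum_nonneg fun _ _ => sq_nonneg _

theorem star_dotProduct_self (φ : ι → ℂ) : star φ ⬝ᵥ φ = (ketNormSq φ : ℂ) := by
  simp only [dotProduct, ketNormSq, Pi.star_apply, Complex.ofReal_sum]
  refine Finset.sum_congr rfl fun z _ => ?_
  rw [Complex.star_def, Complex.conj_mul']
  push_cast
  rfl

theorem ketNormSq_eq_zero {φ : ι → ℂ} : ketNormSq φ = 0 ↔ φ = 0 := by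
  rw [ketNormSq, Finset.sum_eq_zero_iff_of_nonneg fun _ _ => sq_nonneg _]
  simp [funext_iff]

theorem ketNormSq_mulVec {κ : Type} [Fintype κ] [DecidableEq ι] {A : Matrix κ ι ℂ}
    (hA : Aᴴ * A = 1) (φ : ι → ℂ) : ketNormSq (A *ᵥ φ) = ketNormSq φ := by
  have h : star (A *ᵥ φ) ⬝ᵥ (A *ᵥ φ) = star φ ⬝ᵥ φ := by
    rw [star_mulVec, ← dotProduct_mulVec, mulVec_mulVec, hA, one_mulVec]
  rw [star_dotProduct_self, star_dotProduct_self] at h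
  exact_mod_cast h

theorem ketNormSq_smul (a : ℂ) (φ : ι → ℂ) : ketNormSq (a • φ) = ‖a‖ ^ 2 * ketNormSq φ := by
  simp [ketNormSq, Finset.mul_sum, mul_pow]

theorem norm_sub_sq_le_two_mul {E : Type*} [SeminormedAddCommGroup E] (a b : E) :
    ‖a - b‖ ^ 2 ≤ 2 * ‖a‖ ^ 2 + 2 * ‖b‖ ^ 2 := by
  have h := norm_sub_le a b
  nlinarith [norm_nonneg (a - b), norm_nonneg a, norm_nonneg b, sq_nonneg (‖a‖ - ‖b‖)]

theorem ketNormSq_sub_le (φ χ : ι → ℂ) :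
    ketNormSq (φ - χ) ≤ 2 * ketNormSq φ + 2 * ketNormSq χ := by
  simp only [ketNormSq, Finset.mul_sum, ← Finset.sum_add_distrib]
  exact Finset.sum_le_sum fun z _ => norm_sub_sq_le_two_mul _ _

theorem ketNormSq_add_le (φ χ : ι → ℂ) :
    ketNormSq (φ + χ) ≤ 2 * ketNormSq φ + 2 * ketNormSq χ := by
  have h := ketNormSq_sub_le φ (-χ)
  rwa [sub_neg_eq_add, show ketNormSq (-χ) = ketNormSq χ by simp [ketNormSq]] at h

/-- Pythagoras for the component of `φ` orthogonal to a unit vector. -/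
theorem ketNormSq_sub_proj {ψ : ι → ℂ} (hψ : ketNormSq ψ = 1) (φ : ι → ℂ) :
    ketNormSq (φ - (star ψ ⬝ᵥ φ) • ψ) = ketNormSq φ - ‖star ψ ⬝ᵥ φ‖ ^ 2 := by
  have h1 : star ψ ⬝ᵥ ψ = 1 := by rw [star_dotProduct_self, hψ]; simp
  have h2 : star φ ⬝ᵥ ψ = star (star ψ ⬝ᵥ φ) := by
    rw [star_dotProduct]
  have h : star (φ - (star ψ ⬝ᵥ φ) • ψ) ⬝ᵥ (φ - (star ψ ⬝ᵥ φ) • ψ)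
      = star φ ⬝ᵥ φ - star (star ψ ⬝ᵥ φ) * (star ψ ⬝ᵥ φ) := by
    rw [star_sub, star_smul, sub_dotProduct, dotProduct_sub, dotProduct_sub, smul_dotProduct,
      smul_dotProduct, dotProduct_smul, dotProduct_smul, h1, h2]
    simp only [smul_eq_mul]
    ring
  rw [star_dotProduct_self, star_dotProduct_self, Complex.star_def, Complex.conj_mul'] at h
  exact_mod_cast h

end NormSq

/-! ### Expected energies and eigenvalues -/

section Energy

variable {q : Type} [Fintype q] [DecidableEq q]

theorem isState_iff {φ : Ket q} : IsState φ ↔ ketNormSq φ = 1 := by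
  rw [IsState, star_dotProduct_self]
  norm_cast

theorem energy_add (A B : Op q) (φ : Ket q) : energy (A + B) φ = energy A φ + energy B φ := by
  simp [energy, add_mulVec, dotProduct_add]

theorem energy_sum {κ : Type*} (s : Finset κ) (A : κ → Op q) (φ : Ket q) :
    energy (∑ i ∈ s, A i) φ = ∑ i ∈ s, energy (A i) φ := by
  simp [energy, sum_mulVec, dotProduct_sum]

theorem energy_ofReal_smul (r : ℝ) (A : Op q) (φ : Ket q) :
    energy ((r : ℂ) • A) φ = r * energy A φ := by
  simp [energy, smul_mulVec, dotProduct_smul]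

theorem energy_conjTranspose_mul_self (B : Op q) (φ : Ket q) :
    energy (Bᴴ * B) φ = ketNormSq (B *ᵥ φ) := by
  rw [energy, ← mulVec_mulVec, dotProduct_mulVec, ← star_mulVec, star_dotProduct_self,
    Complex.ofReal_re]

theorem energy_of_eigenvector {H : Op q} {e : ℝ} {φ : Ket q} (h : H *ᵥ φ = (e : ℂ) • φ) :
    energy H φ = e * ketNormSq φ := by
  rw [energy, h, dotProduct_smul, star_dotProduct_self]
  simp

theorem mem_energyLevels {H : Op q} {e : ℝ} :
    e ∈ energyLevels H ↔ ∃ φ : Ket q, φ ≠ 0 ∧ H *ᵥ φ = (e : ℂ) • φ := by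
  rw [energyLevels, Set.mem_ofPred_eq, Module.End.hasEigenvalue_iff, Submodule.ne_bot_iff]
  simp [and_comm]

end Energy

/-! ### From a gap inequality to ground state and spectral gap -/

section Spectrum

variable {q : Type} [Fintype q] [DecidableEq q]

/-- A Hermitian operator that annihilates the unit vector `ψ` and is at least `g` on its orthogonal
complement has `ψ` as its non-degenerate ground state. -/
theorem isNondegenerateGroundState_of_gap {H : Op q} {ψ : Ket q}
    (hψ : IsState ψ) (hHψ : H *ᵥ ψ = 0) {g : ℝ} (hg : 0 < g)
    (hgap : ∀ φ, g * (ketNormSq φ - ‖star ψ ⬝ᵥ φ‖ ^ 2) ≤ energy H φ)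
    (hnonneg : ∀ φ, 0 ≤ energy H φ) : IsNondegenerateGroundState H 0 ψ := by
  have hψ1 := isState_iff.1 hψ
  have hψ0 : ψ ≠ 0 := by
    rintro rfl
    simp [ketNormSq] at hψ1
  refine ⟨⟨mem_energyLevels.2 ⟨ψ, hψ0, by simpa using hHψ⟩, fun e he => ?_⟩, hψ, ?_⟩
  · obtain ⟨φ, hφ, h⟩ := mem_energyLevels.1 he
    have h1 := hnonneg φ
    rw [energy_of_eigenvector h] at h1
    have h2 : 0 < ketNormSq φ :=
      (ketNormSq_nonneg φ).lt_of_ne fun h => hφ (ketNormSq_eq_zero.1 h.symm)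
    exact nonneg_of_mul_nonneg_left h1 h2
  · ext φ
    rw [Module.End.mem_eigenspace_iff, Submodule.mem_span_singleton]
    simp only [toLin'_apply, Complex.ofReal_zero, zero_smul]
    constructor
    · intro h
      refine ⟨star ψ ⬝ᵥ φ, ?_⟩
      -- A kernel vector has energy zero, so the gap inequality kills its component orthogonal to
      -- `ψ`.
      have h1 := hgap φ
      rw [← ketNormSq_sub_proj hψ1, energy, h] at h1
      simp only [dotProduct_zero, Complex.zero_re] at h1
      have h2 := ketNormSq_nonneg (φ - (star ψ ⬝ᵥ φ) • ψ)
      exact (sub_eq_zero.1 (ketNormSq_eq_zero.1 (by nlinarith))).symm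
    · rintro ⟨a, rfl⟩
      rw [mulVec_smul, hHψ, smul_zero]

theorem energy_eq_sum_eigenvalues {H : Op q} (hH : H.IsHermitian) (φ : Ket q) :
    energy H φ = ∑ i, hH.eigenvalues i * ‖inner ℂ (hH.eigenvectorBasis i) (WithLp.toLp 2 φ)‖ ^ 2 := by
  set b := hH.eigenvectorBasis
  set v : EuclideanSpace ℂ (q → Fin 2) := WithLp.toLp 2 φ with hv
  have h1 : star φ ⬝ᵥ H *ᵥ φ = inner ℂ v (WithLp.toLp 2 (H *ᵥ φ)) := by
    simp [hv, PiLp.inner_apply, dotProduct, mul_comm]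
  have h2 : ∀ i, inner ℂ (b i) (WithLp.toLp 2 (H *ᵥ φ)) = (hH.eigenvalues i : ℂ) * inner ℂ (b i) v := by
    intro i
    have h3 : ∀ χ : Ket q, inner ℂ (b i) (WithLp.toLp 2 χ) = star (b i).ofLp ⬝ᵥ χ := by
      intro χ
      simp [PiLp.inner_apply, dotProduct, mul_comm]
    rw [h3, hv, h3, dotProduct_mulVec]
    have h4 : star (b i).ofLp ᵥ* H = star (H *ᵥ (b i).ofLp) := by
      rw [star_mulVec, hH.eq]
    rw [h4, hH.mulVec_eigenvectorBasis]
    simp [smul_dotProduct, star_smul, b]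
  rw [energy, h1, ← b.sum_inner_mul_inner v, Complex.re_sum]
  refine Finset.sum_congr rfl fun i _ => ?_
  rw [h2, ← inner_conj_symm v (b i), mul_left_comm, Complex.conj_mul']
  norm_cast

/-- The gap is the least nonzero eigenvalue. Eigenvectors of eigenvalue zero are multiples of `ψ`,
so on the complement of `ψ` only eigenvalues at least the gap contribute to the energy. -/
theorem exists_isSpectralGap [Nonempty q] {H : Op q} (hH : H.IsHermitian) {ψ : Ket q}
    (hHψ : H *ᵥ ψ = 0) (hψ : IsNondegenerateGroundState H 0 ψ) {g : ℝ}
    (hgap : ∀ φ, g * (ketNormSq φ - ‖star ψ ⬝ᵥ φ‖ ^ 2) ≤ energy H φ) :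
    ∃ Δ, IsSpectralGap H Δ ∧ g ≤ Δ ∧
      ∀ φ, IsState φ → Δ * (1 - ‖star ψ ⬝ᵥ φ‖ ^ 2) ≤ energy H φ := by
  obtain ⟨hleast, hstate, hspan⟩ := hψ
  have hψ1 := isState_iff.1 hstate
  set b := hH.eigenvectorBasis with hb
  have hev : ∀ i, H *ᵥ (b i).ofLp = (hH.eigenvalues i : ℂ) • (b i).ofLp := fun i => by
    have := hH.mulVec_eigenvectorBasis i
    simpa [b] using this
  have hbne : ∀ i, (b i).ofLp ≠ 0 := fun i h => by
    have h1 : b i = 0 := by ext j; exact congrFun h j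
    exact b.orthonormal.ne_zero i h1
  have hker : ∀ i, hH.eigenvalues i = 0 → ∃ a : ℂ, a • ψ = (b i).ofLp := fun i hi => by
    rw [← Submodule.mem_span_singleton, ← hspan, Module.End.mem_eigenspace_iff, toLin'_apply, hev,
      hi]
  set S := Finset.univ.filter fun i => hH.eigenvalues i ≠ 0 with hS
  -- A nonempty register has dimension at least two; if all eigenvalues were zero, two orthonormal
  -- eigenvectors would both be multiples of `ψ`.
  have hSne : S.Nonempty := by
    by_contra h
    rw [Finset.not_nonempty_iff_eq_empty, Finset.filter_eq_empty_iff] at h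
    push Not at h
    obtain ⟨i, j, hij⟩ := exists_pair_ne (q → Fin 2)
    obtain ⟨a, ha⟩ := hker i (h (Finset.mem_univ i))
    obtain ⟨a', ha'⟩ := hker j (h (Finset.mem_univ j))
    have h0 := b.orthonormal.2 hij
    have h1 : inner ℂ (b i) (b j) = star a * a' := by
      have : inner ℂ (b i) (b j) = star (b i).ofLp ⬝ᵥ (b j).ofLp := by
        simp [PiLp.inner_apply, dotProduct, mul_comm]
      rw [this, ← ha, ← ha', star_smul, smul_dotProduct, dotProduct_smul, hstate]
      simp
    rw [h0] at h1
    rcases mul_eq_zero.1 h1.symm with h2 | h2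
    · rw [star_eq_zero.1 h2, zero_smul] at ha
      exact hbne i ha.symm
    · rw [h2, zero_smul] at ha'
      exact hbne j ha'.symm
  obtain ⟨i₀, hi₀, hmin⟩ := S.exists_min_image hH.eigenvalues hSne
  have hi₀' : hH.eigenvalues i₀ ≠ 0 := (Finset.mem_filter.1 hi₀).2
  set Δ := hH.eigenvalues i₀ with hΔ
  have hΔ_mem : Δ ∈ energyLevels H := mem_energyLevels.2 ⟨_, hbne i₀, hev i₀⟩
  have hΔ_nonneg : 0 ≤ Δ := hleast.2 hΔ_mem
  have horth : ∀ φ, star ψ ⬝ᵥ φ = 0 → Δ * ketNormSq φ ≤ energy H φ := by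
    intro φ hφ
    rw [energy_eq_sum_eigenvalues hH]
    have h1 : ketNormSq φ = ∑ i, ‖inner ℂ (b i) (WithLp.toLp 2 φ)‖ ^ 2 := by
      rw [b.sum_sq_norm_inner_right, EuclideanSpace.norm_sq_eq]
      rfl
    rw [h1, Finset.mul_sum]
    refine Finset.sum_le_sum fun i _ => ?_
    by_cases hi : hH.eigenvalues i = 0
    · obtain ⟨a, ha⟩ := hker i hi
      have h2 : inner ℂ (b i) (WithLp.toLp 2 φ) = star (b i).ofLp ⬝ᵥ φ := by
        simp [PiLp.inner_apply, dotProduct, mul_comm]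
      rw [h2, ← ha, star_smul, smul_dotProduct, hφ]
      simp
    · exact mul_le_mul_of_nonneg_right (hmin i (by simp [hS, hi])) (sq_nonneg _)
  refine ⟨Δ, ⟨0, Δ, hleast, ⟨⟨hΔ_mem, hi₀'⟩, fun e he => ?_⟩, by simp⟩, ?_, fun φ hφ => ?_⟩
  · have h2 : e ∈ spectrum ℝ H := by
      rw [← spectrum.algebraMap_mem_iff ℂ, ← Matrix.spectrum_toLin']
      exact he.1.mem_spectrum
    rw [hH.spectrum_real_eq_range_eigenvalues] at h2
    obtain ⟨i, rfl⟩ := h2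
    exact hmin i (by simpa [hS] using he.2)
  · have h0 : star ψ ⬝ᵥ (b i₀).ofLp = 0 := by
      have h1 : (Δ : ℂ) * (star ψ ⬝ᵥ (b i₀).ofLp) = 0 := by
        rw [← smul_eq_mul, ← dotProduct_smul, ← hev i₀, dotProduct_mulVec]
        nth_rw 1 [← hH.eq]
        rw [← star_mulVec, hHψ, star_zero, zero_dotProduct]
      exact (mul_eq_zero.1 h1).resolve_left (by exact_mod_cast hi₀')
    have h1 := hgap (b i₀).ofLp
    rw [energy_of_eigenvector (hev i₀), h0] at h1
    have h2 : 0 < ketNormSq (b i₀).ofLp :=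
      (ketNormSq_nonneg _).lt_of_ne fun h => hbne i₀ (ketNormSq_eq_zero.1 h.symm)
    simp only [norm_zero, ne_eq, OfNat.ofNat_ne_zero, not_false_eq_true, zero_pow, sub_zero] at h1
    exact le_of_mul_le_mul_right h1 h2
  · set a := star ψ ⬝ᵥ φ with ha
    have h1 : star ψ ⬝ᵥ (φ - a • ψ) = 0 := by
      rw [dotProduct_sub, dotProduct_smul, hstate, ← ha]
      simp
    have h2 : star ψ ᵥ* H = 0 := by
      nth_rw 1 [← hH.eq]
      rw [← star_mulVec, hHψ, star_zero]
    -- `H` annihilates `ψ` from both sides, so removing the component along `ψ` leaves the energy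
    -- unchanged.
    have h3 : energy H (φ - a • ψ) = energy H φ := by
      rw [energy, energy, mulVec_sub, mulVec_smul, hHψ, smul_zero, sub_zero, star_sub,
        sub_dotProduct, star_smul, smul_dotProduct, dotProduct_mulVec (star ψ), h2,
        zero_dotProduct, smul_zero, sub_zero]
    have h4 := horth _ h1
    rwa [h3, ketNormSq_sub_proj hψ1, isState_iff.1 hφ] at h4

end Spectrum

/-! ### Spans of Pauli strings -/

section Pauli

variable {q : Type} [Fintype q]

/-- The product operator `⨂ i, M i`. -/
def productOp (M : q → Matrix (Fin 2) (Fin 2) ℂ) : Op q := fun x y => ∏ i, M i (x i) (y i)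

/-- The operators that are combinations of the Pauli strings in `S`. -/
noncomputable def pauliSpan (S : Set (q → Fin 4)) : Submodule ℂ (Op q) :=
  Submodule.span ℂ (pauliString '' S)

theorem pauliSpan_mono {S T : Set (q → Fin 4)} (h : S ⊆ T) : pauliSpan S ≤ pauliSpan T :=
  Submodule.span_mono (Set.image_mono h)

theorem pauli_isHermitian (j : Fin 4) : (pauli j).IsHermitian := by
  ext a b
  fin_cases j <;> fin_cases a <;> fin_cases b <;> simp [pauli]

theorem pauliString_isHermitian (α : q → Fin 4) : (pauliString α).IsHermitian := by
  ext x y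
  rw [conjTranspose_apply]
  simp only [pauliString, star_prod]
  exact Finset.prod_congr rfl fun i _ => (pauli_isHermitian (α i)).apply _ _

theorem conjTranspose_mem_pauliSpan {S : Set (q → Fin 4)} {A : Op q} (h : A ∈ pauliSpan S) :
    Aᴴ ∈ pauliSpan S := by
  induction h using Submodule.span_induction with
  | mem A hA =>
    obtain ⟨α, hα, rfl⟩ := hA
    rw [(pauliString_isHermitian α).eq]
    exact Submodule.subset_span ⟨α, hα, rfl⟩
  | zero => simp
  | add A B _ _ hA hB => rw [conjTranspose_add]; exact add_mem hA hB
  | smul a A _ hA => rw [conjTranspose_smul]; exact Submodule.smul_mem _ _ hA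

/-- Expand every tensor factor in its own Pauli matrices and multiply out. -/
theorem productOp_mem_pauliSpan [DecidableEq q] {M : q → Matrix (Fin 2) (Fin 2) ℂ}
    {S : q → Finset (Fin 4)} (h : ∀ i, M i ∈ Submodule.span ℂ (pauli '' (S i : Set (Fin 4)))) :
    productOp M ∈ pauliSpan (Fintype.piFinset S : Set (q → Fin 4)) := by
  choose c hc using fun i => (Submodule.mem_span_image_finset_iff_exists_fun' ℂ).1 (h i)
  have h2 : productOp M = ∑ α ∈ Fintype.piFinset S, (∏ i, c i (α i)) • pauliString α := by
    ext x y
    have h3 : (∑ α ∈ Fintype.piFinset S, (∏ i, c i (α i)) • pauliString α) x y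
        = ∑ α ∈ Fintype.piFinset S, ∏ i, c i (α i) * pauli (α i) (x i) (y i) := by
      rw [Matrix.sum_apply]
      exact Finset.sum_congr rfl fun α _ => by
        rw [Matrix.smul_apply, smul_eq_mul, pauliString, Finset.prod_mul_distrib]
    rw [h3, ← Finset.prod_univ_sum S fun i j => c i j * pauli j (x i) (y i)]
    refine Finset.prod_congr rfl fun i _ => ?_
    rw [← hc i, Matrix.sum_apply]
    rfl
  rw [h2]
  exact Submodule.sum_mem _ fun α hα =>
    Submodule.smul_mem _ _ (Submodule.subset_span ⟨α, hα, rfl⟩)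

/-- A Hermitian operator has real coefficients in the Pauli basis. -/
theorem exists_hamiltonian_eq [DecidableEq q] {H : Op q} (hH : H.IsHermitian)
    {S : Finset (q → Fin 4)} (h : H ∈ pauliSpan (S : Set (q → Fin 4))) :
    ∃ J : (q → Fin 4) → ℝ, hamiltonian J = H ∧ cardinality J ≤ S.card := by
  obtain ⟨c, hc⟩ := (Submodule.mem_span_image_finset_iff_exists_fun' ℂ).1 h
  refine ⟨fun α => if α ∈ S then (c α).re else 0, ?_, ?_⟩
  · have h1 : H = (2⁻¹ : ℂ) • (H + Hᴴ) := by
      rw [hH.eq, ← two_smul ℂ, smul_smul]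
      simp
    rw [h1, ← hc, conjTranspose_sum, ← Finset.sum_add_distrib, Finset.smul_sum, hamiltonian]
    simp only [apply_ite Complex.ofReal, Complex.ofReal_zero, ite_smul, zero_smul]
    rw [Finset.sum_ite_mem, Finset.univ_inter]
    refine Finset.sum_congr rfl fun α _ => ?_
    rw [conjTranspose_smul, (pauliString_isHermitian α).eq, ← add_smul, smul_smul,
      Complex.star_def, Complex.add_conj]
    congr 1
    push_cast
    ring
  · rw [cardinality, ← Set.ncard_coe_finset]
    refine Set.ncard_le_ncard (fun α hα => ?_) S.finite_toSet
    by_contra h2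
    exact hα (if_neg h2)

/-- The Pauli matrices that occur in the matrix unit `|a⟩⟨b|`. -/
def pauliOfUnit (a b : Fin 2) : Finset (Fin 4) := if a = b then {0, 3} else {1, 2}

theorem card_pauliOfUnit (a b : Fin 2) : (pauliOfUnit a b).card = 2 := by
  revert a b; decide

theorem pauli_three : pauli 3 = !![1, 0; 0, -1] := rfl

theorem single_mem_span_pauli (a b : Fin 2) :
    single a b (1 : ℂ) ∈ Submodule.span ℂ (pauli '' (pauliOfUnit a b : Set (Fin 4))) := by
  have key : ∀ i j : Fin 4, ∀ r s : ℂ, single a b (1 : ℂ) = r • pauli i + s • pauli j →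
      pauliOfUnit a b = {i, j} →
      single a b (1 : ℂ) ∈ Submodule.span ℂ (pauli '' (pauliOfUnit a b : Set (Fin 4))) := by
    intro i j r s h h'
    rw [h, h']
    exact add_mem (Submodule.smul_mem _ _ (Submodule.subset_span ⟨i, by simp, rfl⟩))
      (Submodule.smul_mem _ _ (Submodule.subset_span ⟨j, by simp, rfl⟩))
  fin_cases a <;> fin_cases b
  · refine key 0 3 (1 / 2) (1 / 2) ?_ rfl
    rw [pauli_three]
    ext i j; fin_cases i <;> fin_cases j <;> norm_num [pauli]
  · refine key 1 2 (1 / 2) (Complex.I / 2) ?_ rfl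
    ext i j; fin_cases i <;> fin_cases j <;> simp [pauli] <;> ring_nf <;>
      norm_num
  · refine key 1 2 (1 / 2) (-Complex.I / 2) ?_ rfl
    ext i j; fin_cases i <;> fin_cases j <;> simp [pauli] <;> ring_nf <;>
      norm_num
  · refine key 0 3 (1 / 2) (-1 / 2) ?_ rfl
    rw [pauli_three]
    ext i j; fin_cases i <;> fin_cases j <;> norm_num [pauli]

theorem single_mem_span_pauli_univ (a b : Fin 2) :
    single a b (1 : ℂ) ∈ Submodule.span ℂ (pauli '' ((Finset.univ : Finset (Fin 4)) : Set (Fin 4))) :=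
  Submodule.span_mono (Set.image_mono (by simp)) (single_mem_span_pauli a b)

theorem one_mem_span_pauli {S : Finset (Fin 4)} (h : 0 ∈ S) :
    (1 : Matrix (Fin 2) (Fin 2) ℂ) ∈ Submodule.span ℂ (pauli '' (S : Set (Fin 4))) :=
  Submodule.subset_span ⟨0, h, rfl⟩

end Pauli

/-! ### Tensor products and slices of a two-part register -/

section Tensor

variable {a b : Type}

/-- The operator `A ⊗ K` on a register that consists of two parts. -/
def tensorOp (A : Op a) (K : Op b) : Op (a ⊕ b) := fun z w =>
  A (fun i => z (Sum.inl i)) (fun i => w (Sum.inl i)) *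
    K (fun i => z (Sum.inr i)) (fun i => w (Sum.inr i))

theorem tensorOp_conjTranspose (A : Op a) (K : Op b) : (tensorOp A K)ᴴ = tensorOp Aᴴ Kᴴ := by
  ext z w
  simp [tensorOp, conjTranspose_apply]

variable [Fintype a] [Fintype b] [DecidableEq a] [DecidableEq b]

/-- The component of `φ` at the basis state `c` of the second part of the register. -/
def slice (φ : Ket (a ⊕ b)) (c : b → Fin 2) : Ket a := fun x => φ (Sum.elim x c)

theorem sum_register {E : Type*} [AddCommMonoid E] (f : (a ⊕ b → Fin 2) → E) :
    ∑ z, f z = ∑ c : b → Fin 2, ∑ x : a → Fin 2, f (Sum.elim x c) := by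
  rw [← (Equiv.sumArrowEquivProdArrow a b (Fin 2)).symm.sum_comp, Fintype.sum_prod_type_right]
  rfl

theorem ketNormSq_eq_sum_slice (φ : Ket (a ⊕ b)) :
    ketNormSq φ = ∑ c, ketNormSq (slice φ c) := sum_register _

theorem tensorOp_mul (A B : Op a) (K M : Op b) :
    tensorOp A K * tensorOp B M = tensorOp (A * B) (K * M) := by
  ext z w
  rw [mul_apply, sum_register, tensorOp, mul_apply, mul_apply, Finset.sum_mul_sum,
    Finset.sum_comm]
  refine Finset.sum_congr rfl fun x _ => Finset.sum_congr rfl fun c _ => ?_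
  simp only [tensorOp, Sum.elim_inl, Sum.elim_inr]
  ring

theorem slice_tensorOp_mulVec (A : Op a) (K : Op b) (φ : Ket (a ⊕ b)) (c : b → Fin 2) :
    slice (tensorOp A K *ᵥ φ) c = ∑ c', K c c' • (A *ᵥ slice φ c') := by
  ext x
  rw [slice, mulVec, dotProduct, sum_register, Finset.sum_apply]
  refine Finset.sum_congr rfl fun c' _ => ?_
  rw [Pi.smul_apply, mulVec, dotProduct, smul_eq_mul, Finset.mul_sum]
  refine Finset.sum_congr rfl fun y _ => ?_
  simp only [tensorOp, slice, Sum.elim_inl, Sum.elim_inr]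
  ring

theorem slice_tensorOp_single_mulVec (A : Op a) (c₁ c₂ : b → Fin 2) (φ : Ket (a ⊕ b))
    (c : b → Fin 2) :
    slice (tensorOp A (single c₁ c₂ 1) *ᵥ φ) c = if c₁ = c then A *ᵥ slice φ c₂ else 0 := by
  rw [slice_tensorOp_mulVec, Finset.sum_eq_single c₂]
  · by_cases h : c₁ = c <;> simp [h]
  · intro c' _ h
    simp [h.symm]
  · simp

theorem ketNormSq_eq_of_slice {φ : Ket (a ⊕ b)} {c₁ : b → Fin 2} {v : Ket a}
    (h : ∀ c, slice φ c = if c₁ = c then v else 0) : ketNormSq φ = ketNormSq v := by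
  rw [ketNormSq_eq_sum_slice, Finset.sum_eq_single c₁]
  · rw [h, if_pos rfl]
  · intro c _ hc
    rw [h, if_neg hc.symm]
    simp [ketNormSq]
  · simp

end Tensor

/-! ### The binary clock -/

section Clock

variable {m : ℕ}

/-- The binary digits of the time `t` (of `t % 2 ^ m` if `t` is too large for the register). -/
def timeBits (m t : ℕ) : Fin m → Fin 2 := finFunctionFinEquiv.symm (Fin.ofNat (2 ^ m) t)

theorem clockTime_eq (c : Fin m → Fin 2) : clockTime c = (finFunctionFinEquiv c : ℕ) :=
  (finFunctionFinEquiv_apply c).symm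

theorem clockTime_lt (c : Fin m → Fin 2) : clockTime c < 2 ^ m := by
  rw [clockTime_eq]
  exact (finFunctionFinEquiv c).2

theorem clockTime_timeBits {t : ℕ} (h : t < 2 ^ m) : clockTime (timeBits m t) = t := by
  rw [clockTime_eq, timeBits, Equiv.apply_symm_apply]
  exact Nat.mod_eq_of_lt h

theorem timeBits_clockTime (c : Fin m → Fin 2) : timeBits m (clockTime c) = c := by
  rw [timeBits, Equiv.symm_apply_eq, clockTime_eq]
  exact Fin.ofNat_val_eq_self _

theorem timeBits_injOn {s t : ℕ} (hs : s < 2 ^ m) (ht : t < 2 ^ m)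
    (h : timeBits m s = timeBits m t) : s = t := by
  rw [← clockTime_timeBits hs, h, clockTime_timeBits ht]

theorem sum_clock {E : Type*} [AddCommMonoid E] (f : (Fin m → Fin 2) → E) :
    ∑ c, f c = ∑ t ∈ Finset.range (2 ^ m), f (timeBits m t) := by
  symm
  refine Finset.sum_bij (fun t _ => timeBits m t) (by simp) ?_ ?_ (by simp)
  · intro s hs t ht h
    exact timeBits_injOn (Finset.mem_range.1 hs) (Finset.mem_range.1 ht) h
  · intro c _
    exact ⟨clockTime c, Finset.mem_range.2 (clockTime_lt c), timeBits_clockTime c⟩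

end Clock

/-! ### Gates, partial circuits and untouched qubits -/

section Circuits

variable {n k L : ℕ}

/-- Exhibits the gate as a Kronecker product with the identity, up to reindexing, so that it
inherits unitarity. -/
theorem Gate.toOp_eq_submatrix {q : Type} [Fintype q] [DecidableEq q] (U : Gate q k) :
    U.toOp = (kroneckerMap (· * ·) (U.unitary : Matrix (U.support → Fin 2) (U.support → Fin 2) ℂ)
      (1 : Matrix ({i // i ∉ U.support} → Fin 2) ({i // i ∉ U.support} → Fin 2) ℂ)).submatrix
      (Equiv.piEquivPiSubtypeProd (· ∈ U.support) fun _ => Fin 2)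
      (Equiv.piEquivPiSubtypeProd (· ∈ U.support) fun _ => Fin 2) := by
  ext x y
  simp only [Gate.toOp, submatrix_apply, kroneckerMap_apply, Equiv.piEquivPiSubtypeProd_apply,
    one_apply, funext_iff, Subtype.forall, mul_ite, mul_one, mul_zero]

theorem Gate.conjTranspose_toOp_mul_toOp {q : Type} [Fintype q] [DecidableEq q] (U : Gate q k) :
    U.toOpᴴ * U.toOp = 1 := by
  rw [U.toOp_eq_submatrix, conjTranspose_submatrix, submatrix_mul_equiv, conjTranspose_kronecker,
    ← mul_kronecker_mul, conjTranspose_one, one_mul, ← star_eq_conjTranspose,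
    Unitary.coe_star_mul_self, one_kronecker_one, submatrix_one_equiv]

/-- The gate applied at time `t + 1`; the circuit is padded with identity gates. -/
noncomputable def gateAt (U : Fin L → Gate (Fin n) k) (t : ℕ) : Op (Fin n) :=
  if h : t < L then (U ⟨t, h⟩).toOp else 1

/-- The product of the first `t` gates. -/
noncomputable def circuitOp (U : Fin L → Gate (Fin n) k) : ℕ → Op (Fin n)
  | 0 => 1
  | t + 1 => gateAt U t * circuitOp U t

variable (U : Fin L → Gate (Fin n) k)

theorem gateAt_isometry (t : ℕ) : (gateAt U t)ᴴ * gateAt U t = 1 := by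
  rw [gateAt]
  split_ifs with h
  · exact Gate.conjTranspose_toOp_mul_toOp _
  · simp

theorem circuitOp_isometry (t : ℕ) : (circuitOp U t)ᴴ * circuitOp U t = 1 := by
  induction t with
  | zero => simp [circuitOp]
  | succ t ih =>
    rw [circuitOp, conjTranspose_mul, Matrix.mul_assoc, ← Matrix.mul_assoc _ (gateAt U t),
      gateAt_isometry, Matrix.one_mul, ih]

theorem circuitOp_coisometry (t : ℕ) : circuitOp U t * (circuitOp U t)ᴴ = 1 :=
  mul_eq_one_comm.1 (circuitOp_isometry U t)

theorem stateAfter_zero : stateAfter U 0 = ketZero := by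
  simp [stateAfter, prepare]

theorem stateAfter_succ (t : ℕ) : stateAfter U (t + 1) = gateAt U t *ᵥ stateAfter U t := by
  rw [stateAfter, stateAfter, gateAt]
  split_ifs with h
  · rw [List.take_succ_eq_append_getElem (by simpa using h), prepare, List.foldl_append]
    simp [prepare]
  · rw [one_mulVec, List.take_of_length_le (by simp; omega), List.take_of_length_le (by simp; omega)]

theorem stateAfter_eq (t : ℕ) : stateAfter U t = circuitOp U t *ᵥ ketZero := by
  induction t with
  | zero => rw [stateAfter_zero, circuitOp, one_mulVec]
  | succ t ih => rw [stateAfter_succ, ih, mulVec_mulVec, circuitOp]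

theorem stateAfter_of_le {t : ℕ} (h : L ≤ t) : stateAfter U t = output U := by
  rw [stateAfter, output, List.take_of_length_le (by simpa using h)]

theorem ketNormSq_ketZero {q : Type} [Fintype q] [DecidableEq q] :
    ketNormSq (ketZero : Ket q) = 1 := by
  rw [ketNormSq, Finset.sum_eq_single (fun _ => 0)] <;> simp +contextual [ketZero]

theorem ketNormSq_stateAfter (t : ℕ) : ketNormSq (stateAfter U t) = 1 := by
  rw [stateAfter_eq, ketNormSq_mulVec (circuitOp_isometry U t), ketNormSq_ketZero]

/-- The projection on the basis states in which the qubit `i` is `1`. -/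
noncomputable def excited {q : Type} [Fintype q] [DecidableEq q] (i : q) : Op q :=
  diagonal fun x => if x i = 1 then 1 else 0

theorem excited_mulVec {q : Type} [Fintype q] [DecidableEq q] (i : q) (φ : Ket q) (x : q → Fin 2) :
    (excited i *ᵥ φ) x = if x i = 1 then φ x else 0 := by
  simp [excited, mulVec_diagonal]

theorem excited_mul_conjTranspose {q : Type} [Fintype q] [DecidableEq q] (i : q) :
    (excited i)ᴴ * excited i = excited i := by
  rw [excited, diagonal_conjTranspose, diagonal_mul_diagonal]
  congr 1
  ext x
  by_cases h : x i = 1 <;> simp [h]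

/-- Nonzero entries of the gate join only basis strings that agree outside the support, hence at
`i`. This is what allows an idle qubit to be checked at every time. -/
theorem Gate.commute_excited {q : Type} [Fintype q] [DecidableEq q] (U : Gate q k) {i : q}
    (hi : i ∉ U.support) : excited i * U.toOp = U.toOp * excited i := by
  ext x y
  rw [excited, diagonal_mul, mul_diagonal, Gate.toOp]
  by_cases h : ∀ j, j ∉ U.support → x j = y j
  · rw [h i hi, mul_comm]
  · rw [if_neg h, mul_zero, zero_mul]

/-- The qubits on which some gate of the circuit acts. -/
def touched : Finset (Fin n) := Finset.univ.biUnion fun l => (U l).support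

theorem card_touched_le : (touched U).card ≤ L * k := by
  refine (Finset.card_biUnion_le_card_mul _ _ k fun l _ => (U l).card_le).trans ?_
  simp

theorem commute_excited_gateAt {i : Fin n} (hi : i ∉ touched U) (t : ℕ) :
    excited i * gateAt U t = gateAt U t * excited i := by
  rw [gateAt]
  split_ifs with h
  · refine Gate.commute_excited _ fun h' => hi ?_
    exact Finset.mem_biUnion.2 ⟨_, Finset.mem_univ _, h'⟩
  · simp

theorem commute_excited_circuitOp {i : Fin n} (hi : i ∉ touched U) (t : ℕ) :
    excited i * circuitOp U t = circuitOp U t * excited i := by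
  induction t with
  | zero => simp [circuitOp]
  | succ t ih =>
    rw [circuitOp, ← Matrix.mul_assoc, commute_excited_gateAt U hi, Matrix.mul_assoc, ih,
      Matrix.mul_assoc]

end Circuits

/-! ### Poincaré inequalities on a path -/

section Path

/-- Any two values of a function on a path differ by at most the square root of its length times
the Dirichlet energy. -/
theorem norm_sub_sq_le_path (f : ℕ → ℂ) {N s t : ℕ} (hs : s < N) (ht : t < N) :
    ‖f t - f s‖ ^ 2 ≤ N * ∑ j ∈ Finset.range (N - 1), ‖f (j + 1) - f j‖ ^ 2 := by
  wlog h : s ≤ t generalizing s t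
  · rw [norm_sub_rev]
    exact this ht hs (by omega)
  have h1 : f t - f s = ∑ j ∈ Finset.Ico s t, (f (j + 1) - f j) := (Finset.sum_Ico_sub f h).symm
  have h2 : ‖f t - f s‖ ≤ ∑ j ∈ Finset.Ico s t, ‖f (j + 1) - f j‖ := h1 ▸ norm_sum_le _ _
  have h3 : (∑ j ∈ Finset.Ico s t, ‖f (j + 1) - f j‖) ^ 2
      ≤ (Finset.Ico s t).card * ∑ j ∈ Finset.Ico s t, ‖f (j + 1) - f j‖ ^ 2 :=
    sq_sum_le_card_mul_sum_sq
  refine (pow_le_pow_left₀ (norm_nonneg _) h2 2).trans (h3.trans ?_)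
  refine mul_le_mul ?_ ?_ (Finset.sum_nonneg fun _ _ => sq_nonneg _) (Nat.cast_nonneg _)
  · rw [Nat.card_Ico]
    exact_mod_cast (by omega : t - s ≤ N)
  · refine Finset.sum_le_sum_of_subset_of_nonneg (fun j hj => ?_) fun _ _ _ => sq_nonneg _
    rw [Finset.mem_Ico] at hj
    rw [Finset.mem_range]
    omega

/-- The Poincaré inequality on a path. -/
theorem variance_le_path (f : ℕ → ℂ) {N : ℕ} (hN : 0 < N) :
    ∑ t ∈ Finset.range N, ‖f t‖ ^ 2 - ‖∑ t ∈ Finset.range N, f t‖ ^ 2 / N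
      ≤ N ^ 2 * (2⁻¹ * ∑ j ∈ Finset.range (N - 1), ‖f (j + 1) - f j‖ ^ 2) := by
  -- The variance times `2 * N` is the sum of all squared pairwise differences, each of which the
  -- path bound controls.
  have h1 : ∑ s ∈ Finset.range N, ∑ t ∈ Finset.range N, ‖f t - f s‖ ^ 2
      = 2 * (N * ∑ t ∈ Finset.range N, ‖f t‖ ^ 2) - 2 * ‖∑ t ∈ Finset.range N, f t‖ ^ 2 := by
    have h2 : ‖∑ t ∈ Finset.range N, f t‖ ^ 2
        = ∑ s ∈ Finset.range N, ∑ t ∈ Finset.range N, inner ℝ (f t) (f s) := by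
      rw [← real_inner_self_eq_norm_sq, inner_sum]
      exact Finset.sum_congr rfl fun s _ => sum_inner _ _ _
    simp only [h2, norm_sub_sq_real, Finset.sum_add_distrib, Finset.sum_sub_distrib,
      ← Finset.mul_sum, Finset.sum_const, Finset.card_range, nsmul_eq_mul]
    ring
  have h2 : ∑ s ∈ Finset.range N, ∑ t ∈ Finset.range N, ‖f t - f s‖ ^ 2
      ≤ ∑ _s ∈ Finset.range N, ∑ _t ∈ Finset.range N,
        (N * ∑ j ∈ Finset.range (N - 1), ‖f (j + 1) - f j‖ ^ 2 : ℝ) :=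
    Finset.sum_le_sum fun s hs => Finset.sum_le_sum fun t ht =>
      norm_sub_sq_le_path f (Finset.mem_range.1 hs) (Finset.mem_range.1 ht)
  simp only [Finset.sum_const, Finset.card_range, nsmul_eq_mul] at h2
  rw [h1] at h2
  have h3 : (0 : ℝ) < N := by exact_mod_cast hN
  have h4 : ‖∑ t ∈ Finset.range N, f t‖ ^ 2 / N * N = ‖∑ t ∈ Finset.range N, f t‖ ^ 2 :=
    div_mul_cancel₀ _ h3.ne'
  refine le_of_mul_le_mul_right ?_ h3
  nlinarith

/-- A penalty at the starting point removes the constant mode, so the full norm is controlled and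
not only the variance. -/
theorem sum_norm_sq_le_path (f : ℕ → ℂ) {N : ℕ} (hN : 0 < N) :
    ∑ t ∈ Finset.range N, ‖f t‖ ^ 2
      ≤ 4 * N ^ 2 * (2⁻¹ * ∑ j ∈ Finset.range (N - 1), ‖f (j + 1) - f j‖ ^ 2 + ‖f 0‖ ^ 2) := by
  set D := ∑ j ∈ Finset.range (N - 1), ‖f (j + 1) - f j‖ ^ 2 with hD
  have h1 : ∀ t ∈ Finset.range N, ‖f t‖ ^ 2 ≤ 2 * (N * D) + 2 * ‖f 0‖ ^ 2 := by
    intro t ht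
    have h2 := norm_sub_sq_le_path f hN (Finset.mem_range.1 ht)
    have h3 := norm_sub_sq_le_two_mul (f t - f 0) (-f 0)
    rw [sub_neg_eq_add, sub_add_cancel, norm_neg] at h3
    linarith
  have h2 := Finset.sum_le_sum h1
  simp only [Finset.sum_const, Finset.card_range, nsmul_eq_mul] at h2
  have h3 : (1 : ℝ) ≤ N := by exact_mod_cast hN
  have h4 : (N : ℝ) * ‖f 0‖ ^ 2 ≤ N ^ 2 * ‖f 0‖ ^ 2 :=
    mul_le_mul_of_nonneg_right (by nlinarith) (sq_nonneg _)
  have h5 : 0 ≤ (N : ℝ) ^ 2 * ‖f 0‖ ^ 2 := by positivity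
  nlinarith

end Path

/-! ### The history Hamiltonian, its kernel and its gap -/

section Hamiltonian

variable {n k L : ℕ} (U : Fin L → Gate (Fin n) k) (m : ℕ)

/-- The operator that compares the data register at time `t + 1` with the gate applied to the data
register at time `t`. -/
noncomputable def propagation (t : ℕ) : Op (Fin n ⊕ Fin m) :=
  tensorOp 1 (single (timeBits m t) (timeBits m (t + 1)) 1) -
    tensorOp (gateAt U t) (single (timeBits m t) (timeBits m t) 1)

/-- The check that the qubit `i` is `0` at the start; a qubit without gates is checked at any
time. -/
noncomputable def initialCheck (i : Fin n) : Op (Fin n ⊕ Fin m) :=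
  if i ∈ touched U then tensorOp (excited i) (single (timeBits m 0) (timeBits m 0) 1)
  else tensorOp (excited i) 1

/-- The circuit-to-Hamiltonian construction with a binary clock. -/
noncomputable def historyHamiltonian : Op (Fin n ⊕ Fin m) :=
  ((2⁻¹ : ℝ) : ℂ) • ∑ t ∈ Finset.range (2 ^ m - 1), (propagation U m t)ᴴ * propagation U m t +
    ∑ i, (initialCheck U m i)ᴴ * initialCheck U m i

theorem historyHamiltonian_isHermitian : (historyHamiltonian U m).IsHermitian := by
  rw [IsHermitian, historyHamiltonian, conjTranspose_add, conjTranspose_smul, conjTranspose_sum,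
    conjTranspose_sum]
  simp [conjTranspose_mul]

theorem energy_historyHamiltonian (φ : Ket (Fin n ⊕ Fin m)) :
    energy (historyHamiltonian U m) φ
      = 2⁻¹ * ∑ t ∈ Finset.range (2 ^ m - 1), ketNormSq (propagation U m t *ᵥ φ) +
        ∑ i, ketNormSq (initialCheck U m i *ᵥ φ) := by
  simp only [historyHamiltonian, energy_add, energy_ofReal_smul, energy_sum,
    energy_conjTranspose_mul_self]

theorem energy_historyHamiltonian_nonneg (φ : Ket (Fin n ⊕ Fin m)) :
    0 ≤ energy (historyHamiltonian U m) φ := by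
  rw [energy_historyHamiltonian]
  have h1 : 0 ≤ ∑ t ∈ Finset.range (2 ^ m - 1), ketNormSq (propagation U m t *ᵥ φ) :=
    Finset.sum_nonneg fun _ _ => ketNormSq_nonneg _
  have h2 : 0 ≤ ∑ i, ketNormSq (initialCheck U m i *ᵥ φ) :=
    Finset.sum_nonneg fun _ _ => ketNormSq_nonneg _
  positivity

variable {m}

/-- Both terms of the propagation operator write into the single clock state `t`, so only one slice
of the image is nonzero. -/
theorem ketNormSq_propagation_mulVec (t : ℕ) (φ : Ket (Fin n ⊕ Fin m)) :
    ketNormSq (propagation U m t *ᵥ φ) =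
      ketNormSq (slice φ (timeBits m (t + 1)) - gateAt U t *ᵥ slice φ (timeBits m t)) := by
  refine ketNormSq_eq_of_slice (c₁ := timeBits m t) fun c => ?_
  have h : ∀ χ ξ : Ket (Fin n ⊕ Fin m), slice (χ - ξ) c = slice χ c - slice ξ c := fun _ _ => rfl
  rw [propagation, sub_mulVec, h, slice_tensorOp_single_mulVec, slice_tensorOp_single_mulVec]
  split_ifs <;> simp

theorem ketNormSq_initialCheck_mulVec (i : Fin n) (φ : Ket (Fin n ⊕ Fin m)) :
    ketNormSq (initialCheck U m i *ᵥ φ) =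
      if i ∈ touched U then ketNormSq (excited i *ᵥ slice φ (timeBits m 0))
      else ∑ t ∈ Finset.range (2 ^ m), ketNormSq (excited i *ᵥ slice φ (timeBits m t)) := by
  rw [initialCheck]
  split_ifs
  · exact ketNormSq_eq_of_slice fun c => slice_tensorOp_single_mulVec _ _ _ _ _
  · rw [ketNormSq_eq_sum_slice, sum_clock]
    refine Finset.sum_congr rfl fun t _ => ?_
    rw [slice_tensorOp_mulVec]
    simp [one_apply]

theorem ketNormSq_eq_sum_time (φ : Ket (Fin n ⊕ Fin m)) :
    ketNormSq φ = ∑ t ∈ Finset.range (2 ^ m), ketNormSq (slice φ (timeBits m t)) := by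
  rw [ketNormSq_eq_sum_slice, sum_clock]

theorem ketNormSq_excited_mulVec_le (i : Fin n) (v : Ket (Fin n)) :
    ketNormSq (excited i *ᵥ v) ≤ ketNormSq v := by
  refine Finset.sum_le_sum fun x _ => ?_
  rw [excited_mulVec]
  split_ifs
  · rfl
  · simp

theorem energy_historyHamiltonian_le (φ : Ket (Fin n ⊕ Fin m)) :
    energy (historyHamiltonian U m) φ ≤ (n + 2) * ketNormSq φ := by
  have hpos : 0 < 2 ^ m := by positivity
  rw [energy_historyHamiltonian]
  have h1 : ∑ i, ketNormSq (initialCheck U m i *ᵥ φ) ≤ n * ketNormSq φ := by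
    have h : ∀ i ∈ Finset.univ, ketNormSq (initialCheck U m i *ᵥ φ) ≤ ketNormSq φ := by
      intro i _
      rw [ketNormSq_initialCheck_mulVec, ketNormSq_eq_sum_time φ]
      split_ifs
      · refine (ketNormSq_excited_mulVec_le _ _).trans ?_
        exact Finset.single_le_sum (f := fun t => ketNormSq (slice φ (timeBits m t)))
          (fun _ _ => ketNormSq_nonneg _) (Finset.mem_range.2 hpos)
      · exact Finset.sum_le_sum fun t _ => ketNormSq_excited_mulVec_le _ _
    simpa using Finset.sum_le_card_nsmul _ _ _ h
  -- Each slice occurs in at most two propagation terms, with weight two each time.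
  have h2 : ∑ t ∈ Finset.range (2 ^ m - 1), ketNormSq (propagation U m t *ᵥ φ)
      ≤ 4 * ketNormSq φ := by
    have h3 : ∀ t ∈ Finset.range (2 ^ m - 1), ketNormSq (propagation U m t *ᵥ φ)
        ≤ 2 * ketNormSq (slice φ (timeBits m (t + 1))) + 2 * ketNormSq (slice φ (timeBits m t)) := by
      intro t _
      rw [ketNormSq_propagation_mulVec, ← ketNormSq_mulVec (gateAt_isometry U t)
        (slice φ (timeBits m t))]
      exact ketNormSq_sub_le _ _
    refine (Finset.sum_le_sum h3).trans ?_
    rw [Finset.sum_add_distrib, ← Finset.mul_sum, ← Finset.mul_sum]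
    have h4 := Finset.sum_range_succ (fun t => ketNormSq (slice φ (timeBits m t))) (2 ^ m - 1)
    have h5 := Finset.sum_range_succ' (fun t => ketNormSq (slice φ (timeBits m t))) (2 ^ m - 1)
    rw [Nat.sub_add_cancel hpos, ← ketNormSq_eq_sum_time] at h4 h5
    have h6 := ketNormSq_nonneg (slice φ (timeBits m (2 ^ m - 1)))
    have h7 := ketNormSq_nonneg (slice φ (timeBits m 0))
    linarith
  linarith

/-- The state of the data register at time `t`, with the first `t` gates undone. -/
noncomputable def rotatedSlice (φ : Ket (Fin n ⊕ Fin m)) (t : ℕ) : Ket (Fin n) :=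
  (circuitOp U t)ᴴ *ᵥ slice φ (timeBits m t)

theorem ketNormSq_circuitOp_conjTranspose_mulVec (t : ℕ) (v : Ket (Fin n)) :
    ketNormSq ((circuitOp U t)ᴴ *ᵥ v) = ketNormSq v :=
  ketNormSq_mulVec (by rw [conjTranspose_conjTranspose, circuitOp_coisometry]) v

/-- Undoing the first `t + 1` gates cancels the gate at time `t`; what remains is the plain
difference along a path. -/
theorem ketNormSq_propagation_mulVec_eq_rotated (t : ℕ) (φ : Ket (Fin n ⊕ Fin m)) :
    ketNormSq (propagation U m t *ᵥ φ) =
      ketNormSq (rotatedSlice U φ (t + 1) - rotatedSlice U φ t) := by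
  rw [ketNormSq_propagation_mulVec, ← ketNormSq_circuitOp_conjTranspose_mulVec U (t + 1),
    mulVec_sub, mulVec_mulVec, rotatedSlice, rotatedSlice]
  congr 3
  rw [circuitOp, conjTranspose_mul, Matrix.mul_assoc, gateAt_isometry, Matrix.mul_one]

/-- No gate has been undone at time zero, and the check of an untouched qubit commutes with the
circuit, so in either case the check stays diagonal in the rotated frame. -/
theorem ketNormSq_initialCheck_mulVec_eq_rotated (i : Fin n) (φ : Ket (Fin n ⊕ Fin m)) :
    ketNormSq (initialCheck U m i *ᵥ φ) = ∑ x : Fin n → Fin 2, if x i = 1 then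
      (if i ∈ touched U then ‖rotatedSlice U φ 0 x‖ ^ 2
        else ∑ t ∈ Finset.range (2 ^ m), ‖rotatedSlice U φ t x‖ ^ 2) else 0 := by
  have key : ∀ v : Ket (Fin n), ketNormSq (excited i *ᵥ v) = ∑ x, if x i = 1 then ‖v x‖ ^ 2 else 0 := by
    intro v
    refine Finset.sum_congr rfl fun x _ => ?_
    rw [excited_mulVec]
    split_ifs <;> simp
  rw [ketNormSq_initialCheck_mulVec]
  split_ifs with h
  · rw [key]
    simp [rotatedSlice, circuitOp]
  · have h1 : ∀ t, ketNormSq (excited i *ᵥ slice φ (timeBits m t))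
        = ∑ x, if x i = 1 then ‖rotatedSlice U φ t x‖ ^ 2 else 0 := by
      intro t
      have hE : (excited i : Op (Fin n))ᴴ = excited i := by
        rw [← excited_mul_conjTranspose, conjTranspose_mul, conjTranspose_conjTranspose]
      have h2 : (circuitOp U t)ᴴ * excited i = excited i * (circuitOp U t)ᴴ := by
        have h3 := congrArg conjTranspose (commute_excited_circuitOp U h t)
        rwa [conjTranspose_mul, conjTranspose_mul, hE] at h3
      rw [← ketNormSq_circuitOp_conjTranspose_mulVec U t, mulVec_mulVec, h2, ← mulVec_mulVec, key]
      rfl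
    simp only [h1]
    rw [Finset.sum_comm]
    refine Finset.sum_congr rfl fun x _ => ?_
    split_ifs <;> simp

theorem slice_historyState (c : Fin m → Fin 2) :
    slice (historyState U m 0) c =
      ((1 / Real.sqrt (2 ^ m) : ℝ) : ℂ) • stateAfter U (clockTime c) := rfl

theorem star_ketZero_dotProduct {q : Type} [Fintype q] [DecidableEq q] (v : Ket q) :
    star (ketZero : Ket q) ⬝ᵥ v = v (fun _ => 0) := by
  rw [dotProduct, Finset.sum_eq_single (fun _ => 0)] <;> simp +contextual [ketZero]

/-- In the rotated frame the history state is the uniform superposition over the clock of `ketZero`,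
so only the zero string contributes. -/
theorem star_historyState_dotProduct (φ : Ket (Fin n ⊕ Fin m)) :
    star (historyState U m 0) ⬝ᵥ φ = ((1 / Real.sqrt (2 ^ m) : ℝ) : ℂ) *
      ∑ t ∈ Finset.range (2 ^ m), rotatedSlice U φ t (fun _ => 0) := by
  have h1 : star (historyState U m 0) ⬝ᵥ φ
      = ∑ c, star (slice (historyState U m 0) c) ⬝ᵥ slice φ c := sum_register _
  rw [h1, sum_clock, Finset.mul_sum]
  refine Finset.sum_congr rfl fun t ht => ?_
  rw [slice_historyState, clockTime_timeBits (Finset.mem_range.1 ht), star_smul, smul_dotProduct,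
    stateAfter_eq, star_mulVec, ← dotProduct_mulVec, star_ketZero_dotProduct, rotatedSlice,
    Complex.star_def, Complex.conj_ofReal, smul_eq_mul]

theorem norm_star_historyState_dotProduct_sq (φ : Ket (Fin n ⊕ Fin m)) :
    ‖star (historyState U m 0) ⬝ᵥ φ‖ ^ 2 =
      ‖∑ t ∈ Finset.range (2 ^ m), rotatedSlice U φ t (fun _ => 0)‖ ^ 2 / (2 ^ m : ℕ) := by
  rw [star_historyState_dotProduct, norm_mul, mul_pow, Complex.norm_real, Real.norm_eq_abs, sq_abs,
    div_pow, Real.sq_sqrt (by positivity)]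
  push_cast
  ring

theorem ketNormSq_historyState : ketNormSq (historyState U m 0) = 1 := by
  rw [ketNormSq_eq_sum_time]
  simp only [slice_historyState, ketNormSq_smul, ketNormSq_stateAfter]
  rw [Finset.sum_const, Finset.card_range, Complex.norm_real, Real.norm_eq_abs, sq_abs,
    div_pow, Real.sq_sqrt (by positivity)]
  simp

theorem propagation_mulVec_historyState {t : ℕ} (ht : t + 1 < 2 ^ m) :
    propagation U m t *ᵥ historyState U m 0 = 0 := by
  rw [← ketNormSq_eq_zero, ketNormSq_propagation_mulVec, ketNormSq_eq_zero, slice_historyState,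
    slice_historyState, clockTime_timeBits ht, clockTime_timeBits (by omega), mulVec_smul,
    stateAfter_succ, sub_self]

theorem excited_mulVec_ketZero {q : Type} [Fintype q] [DecidableEq q] (i : q) :
    excited i *ᵥ (ketZero : Ket q) = 0 := by
  ext x
  rw [excited_mulVec, ketZero]
  split_ifs with h
  · rw [Pi.single_apply, if_neg]
    · rfl
    · rintro rfl
      simp at h
  · rfl

theorem initialCheck_mulVec_historyState (i : Fin n) :
    initialCheck U m i *ᵥ historyState U m 0 = 0 := by
  have hpos : 0 < 2 ^ m := by positivity
  rw [← ketNormSq_eq_zero, ketNormSq_initialCheck_mulVec]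
  split_ifs with h
  · rw [slice_historyState, clockTime_timeBits hpos, stateAfter_zero, mulVec_smul,
      excited_mulVec_ketZero, smul_zero, ketNormSq_eq_zero]
  · refine Finset.sum_eq_zero fun t ht => ?_
    rw [slice_historyState, clockTime_timeBits (Finset.mem_range.1 ht), stateAfter_eq, mulVec_smul,
      mulVec_mulVec, commute_excited_circuitOp U h, ← mulVec_mulVec, excited_mulVec_ketZero,
      mulVec_zero, smul_zero, ketNormSq_eq_zero]

theorem historyHamiltonian_mulVec_historyState :
    historyHamiltonian U m *ᵥ historyState U m 0 = 0 := by
  rw [historyHamiltonian, add_mulVec, smul_mulVec, sum_mulVec, sum_mulVec, Finset.sum_eq_zero,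
    Finset.sum_eq_zero, smul_zero, add_zero]
  · intro i _
    rw [← mulVec_mulVec, initialCheck_mulVec_historyState, mulVec_zero]
  · intro t ht
    rw [← mulVec_mulVec, propagation_mulVec_historyState U (by rw [Finset.mem_range] at ht; omega),
      mulVec_zero]

/-- The energy above the history state is at least of the order of the inverse square of the number
of time steps. -/
theorem energy_historyHamiltonian_ge (φ : Ket (Fin n ⊕ Fin m)) :
    1 / (4 * (2 ^ m : ℝ) ^ 2) * (ketNormSq φ - ‖star (historyState U m 0) ⬝ᵥ φ‖ ^ 2)
      ≤ energy (historyHamiltonian U m) φ := by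
  have hpos : 0 < 2 ^ m := by positivity
  set N := 2 ^ m with hN
  have hNr : (2 ^ m : ℝ) = (N : ℝ) := by rw [hN]; push_cast; rfl
  have hN0 : (0 : ℝ) < 4 * (N : ℝ) ^ 2 := by positivity
  set χ := rotatedSlice U φ with hχ
  -- `D x` and `C x` are the propagation and check energies of the string `x`; in the rotated frame
  -- different strings do not interact.
  set D : (Fin n → Fin 2) → ℝ := fun x =>
    2⁻¹ * ∑ t ∈ Finset.range (N - 1), ‖χ (t + 1) x - χ t x‖ ^ 2 with hD
  set C : (Fin n → Fin 2) → ℝ := fun x => ∑ i, if x i = 1 then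
      (if i ∈ touched U then ‖χ 0 x‖ ^ 2 else ∑ t ∈ Finset.range N, ‖χ t x‖ ^ 2) else 0 with hC
  have hD0 : ∀ x, 0 ≤ D x := fun x =>
    mul_nonneg (by norm_num) (Finset.sum_nonneg fun _ _ => sq_nonneg _)
  have hterm : ∀ x : Fin n → Fin 2, ∀ i ∈ Finset.univ, 0 ≤ if x i = 1 then
      (if i ∈ touched U then ‖χ 0 x‖ ^ 2 else ∑ t ∈ Finset.range N, ‖χ t x‖ ^ 2) else 0 := by
    intro x i _
    have h : 0 ≤ ∑ t ∈ Finset.range N, ‖χ t x‖ ^ 2 := Finset.sum_nonneg fun _ _ => sq_nonneg _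
    split_ifs <;> positivity
  have hC0 : ∀ x, 0 ≤ C x := fun x => Finset.sum_nonneg (hterm x)
  have hE : energy (historyHamiltonian U m) φ = ∑ x, (D x + C x) := by
    rw [energy_historyHamiltonian, Finset.sum_add_distrib, hD, hC, ← Finset.mul_sum,
      Finset.sum_comm, Finset.sum_comm (s := Finset.univ (α := Fin n → Fin 2))]
    congr 1
    · congr 1
      refine Finset.sum_congr rfl fun t _ => ?_
      rw [ketNormSq_propagation_mulVec_eq_rotated]
      rfl
    · refine Finset.sum_congr rfl fun i _ => ?_
      rw [ketNormSq_initialCheck_mulVec_eq_rotated]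
  have hnorm : ketNormSq φ = ∑ x, ∑ t ∈ Finset.range N, ‖χ t x‖ ^ 2 := by
    rw [ketNormSq_eq_sum_time, Finset.sum_comm]
    refine Finset.sum_congr rfl fun t _ => ?_
    rw [← ketNormSq_circuitOp_conjTranspose_mulVec U t]
    rfl
  -- A nonzero string has a bit `1`. Its check penalises the path at time zero if the qubit is
  -- touched, and at every time otherwise.
  have hoff : ∀ x : Fin n → Fin 2, x ≠ (fun _ => 0) →
      ∑ t ∈ Finset.range N, ‖χ t x‖ ^ 2 ≤ 4 * N ^ 2 * (D x + C x) := by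
    intro x hx
    obtain ⟨i, hi⟩ := Function.ne_iff.1 hx
    have hi1 : x i = 1 := by
      have : ∀ a : Fin 2, a ≠ 0 → a = 1 := by decide
      exact this _ hi
    have hCi := Finset.single_le_sum (hterm x) (Finset.mem_univ i)
    rw [if_pos hi1] at hCi
    by_cases hT : i ∈ touched U
    · rw [if_pos hT] at hCi
      refine (sum_norm_sq_le_path (fun t => χ t x) hpos).trans ?_
      exact mul_le_mul_of_nonneg_left (add_le_add le_rfl hCi) hN0.le
    · rw [if_neg hT] at hCi
      have h1 : (1 : ℝ) ≤ 4 * N ^ 2 := by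
        have : (1 : ℝ) ≤ N := by exact_mod_cast hpos
        nlinarith
      have h2 : C x ≤ D x + C x := by linarith [hD0 x]
      exact (hCi.trans h2).trans (le_mul_of_one_le_left (add_nonneg (hD0 x) (hC0 x)) h1)
  -- The zero string passes all checks; only its deviation from a constant in time costs energy, and
  -- its mean is the overlap with the history state.
  have hzero : ∑ t ∈ Finset.range N, ‖χ t (fun _ => 0)‖ ^ 2
      - ‖∑ t ∈ Finset.range N, χ t (fun _ => 0)‖ ^ 2 / N
      ≤ 4 * N ^ 2 * (D (fun _ => 0) + C (fun _ => 0)) := by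
    refine (variance_le_path (fun t => χ t (fun _ => 0)) hpos).trans ?_
    have h1 := hD0 (fun _ => 0)
    have h2 := hC0 (fun _ => 0)
    refine mul_le_mul ?_ (le_add_of_nonneg_right h2) h1 hN0.le
    nlinarith [sq_nonneg (N : ℝ)]
  rw [hNr, one_div, inv_mul_le_iff₀ hN0, norm_star_historyState_dotProduct_sq, hE, hnorm,
    ← Finset.add_sum_erase _ _ (Finset.mem_univ (fun _ => 0)),
    ← Finset.add_sum_erase _ (fun x => D x + C x) (Finset.mem_univ (fun _ => 0)), mul_add,
    Finset.mul_sum]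
  have hrest := Finset.sum_le_sum fun x (hx : x ∈ Finset.univ.erase (fun _ => 0)) =>
    hoff x (Finset.ne_of_mem_erase hx)
  rw [← hN, ← hχ]
  linarith

end Hamiltonian

/-! ### Pauli expansions of gates, projections and matrix units -/

section PauliTerms

theorem productOp_one {q : Type} [Fintype q] [DecidableEq q] :
    productOp (fun _ : q => (1 : Matrix (Fin 2) (Fin 2) ℂ)) = 1 := by
  ext x y
  simp only [productOp, one_apply, Finset.prod_ite_zero, Finset.mem_univ, true_implies,
    Finset.prod_const_one, funext_iff]

theorem single_eq_productOp {q : Type} [Fintype q] [DecidableEq q] (c c' : q → Fin 2) :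
    (single c c' 1 : Op q) = productOp fun i => single (c i) (c' i) 1 := by
  ext x y
  simp only [productOp, single_apply, Finset.prod_ite_zero, Finset.mem_univ, true_implies,
    Finset.prod_const_one, funext_iff, forall_and]

/-- Expanding the unitary in matrix units of its support gives product operators, to which
`productOp_mem_pauliSpan` applies. -/
theorem Gate.toOp_eq_sum_productOp {q : Type} [Fintype q] [DecidableEq q] {k : ℕ} (U : Gate q k) :
    U.toOp = ∑ a : U.support → Fin 2, ∑ b : U.support → Fin 2,
      (U.unitary : Matrix (U.support → Fin 2) (U.support → Fin 2) ℂ) a b •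
        productOp fun i => if h : i ∈ U.support then single (a ⟨i, h⟩) (b ⟨i, h⟩) 1 else 1 := by
  have key : ∀ (a b : U.support → Fin 2) (x y : q → Fin 2),
      productOp (fun i => if h : i ∈ U.support then
        (single (a ⟨i, h⟩) (b ⟨i, h⟩) 1 : Matrix (Fin 2) (Fin 2) ℂ) else 1) x y =
      if ∀ i, i ∉ U.support → x i = y i then
        if a = (fun i : U.support => x i) then if b = (fun i : U.support => y i) then (1 : ℂ) else 0 else 0 else 0 := by
    intro a b x y
    have h1 : ∀ i, (if h : i ∈ U.support then
        (single (a ⟨i, h⟩) (b ⟨i, h⟩) 1 : Matrix (Fin 2) (Fin 2) ℂ) else 1) (x i) (y i) =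
        if (∀ h : i ∈ U.support, a ⟨i, h⟩ = x i ∧ b ⟨i, h⟩ = y i) ∧ (i ∉ U.support → x i = y i)
        then 1 else 0 := by
      intro i
      by_cases h : i ∈ U.support
      · simp [h, single_apply]
      · simp [h, one_apply]
    simp only [productOp, h1, Finset.prod_ite_zero, Finset.mem_univ, true_implies,
      Finset.prod_const_one, forall_and, ← ite_and, funext_iff, Subtype.forall]
    congr 1
    simp only [eq_iff_iff]
    tauto
  ext x y
  simp only [Matrix.sum_apply, Matrix.smul_apply, key, Gate.toOp, smul_eq_mul]
  split_ifs
  · simp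
  · simp

variable {q : Type} [Fintype q] [DecidableEq q]

theorem one_mem_pauliSpan {S : q → Finset (Fin 4)} (h : ∀ i, 0 ∈ S i) :
    (1 : Op q) ∈ pauliSpan (Fintype.piFinset S : Set (q → Fin 4)) := by
  rw [← productOp_one]
  exact productOp_mem_pauliSpan fun i => one_mem_span_pauli (h i)

theorem single_mem_pauliSpan (c c' : q → Fin 2) : (single c c' 1 : Op q) ∈
    pauliSpan (Fintype.piFinset fun i => pauliOfUnit (c i) (c' i) : Set (q → Fin 4)) := by
  rw [single_eq_productOp]
  exact productOp_mem_pauliSpan fun i => single_mem_span_pauli _ _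

/-- The Pauli matrices that can occur at each qubit in an operator acting on `s`. -/
def pauliOn (s : Finset q) (i : q) : Finset (Fin 4) := if i ∈ s then Finset.univ else {0}

theorem Gate.toOp_mem_pauliSpan {k : ℕ} (U : Gate q k) :
    U.toOp ∈ pauliSpan (Fintype.piFinset (pauliOn U.support) : Set (q → Fin 4)) := by
  rw [U.toOp_eq_sum_productOp]
  refine Submodule.sum_mem _ fun a _ => Submodule.sum_mem _ fun b _ => Submodule.smul_mem _ _ ?_
  refine productOp_mem_pauliSpan fun i => ?_
  rw [pauliOn]
  split_ifs with h
  · exact single_mem_span_pauli_univ _ _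
  · exact one_mem_span_pauli (by simp)

/-- The Pauli matrices that occur at each qubit in the projection `excited i`. -/
def pauliOfExcited (i j : q) : Finset (Fin 4) := if j = i then {0, 3} else {0}

theorem excited_mem_pauliSpan (i : q) :
    excited i ∈ pauliSpan (Fintype.piFinset (pauliOfExcited i) : Set (q → Fin 4)) := by
  have h : excited i = productOp fun j => if j = i then single (1 : Fin 2) 1 1 else 1 := by
    ext x y
    have h1 : ∀ j, (if j = i then single (1 : Fin 2) 1 1 else 1 : Matrix (Fin 2) (Fin 2) ℂ)
        (x j) (y j) = if x j = y j ∧ (j = i → x j = 1) then 1 else 0 := by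
      intro j
      by_cases h : j = i
      · simp only [h, if_true, single_apply, true_implies]
        congr 1
        simp only [eq_iff_iff]
        constructor
        · rintro ⟨h1, h2⟩
          exact ⟨h1.symm.trans h2, h1.symm⟩
        · rintro ⟨h1, h2⟩
          exact ⟨h2.symm, h2.symm.trans h1⟩
      · simp [h, one_apply]
    simp only [productOp, h1, Finset.prod_ite_zero, Finset.mem_univ, true_implies,
      Finset.prod_const_one, forall_eq, excited, diagonal_apply, funext_iff, ite_and]
  rw [h]
  refine productOp_mem_pauliSpan fun j => ?_
  rw [pauliOfExcited]
  split_ifs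
  · exact single_mem_span_pauli 1 1
  · exact one_mem_span_pauli (by simp)

theorem tensorOp_mem_pauliSpan {a b : Type} [Fintype a] [Fintype b] [DecidableEq a] [DecidableEq b]
    {S : a → Finset (Fin 4)} {T : b → Finset (Fin 4)} {A : Op a} {K : Op b}
    (hA : A ∈ pauliSpan (Fintype.piFinset S : Set (a → Fin 4)))
    (hK : K ∈ pauliSpan (Fintype.piFinset T : Set (b → Fin 4))) :
    tensorOp A K ∈ pauliSpan (Fintype.piFinset (Sum.elim S T) : Set (a ⊕ b → Fin 4)) := by
  induction hA using Submodule.span_induction with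
  | mem A hA =>
    obtain ⟨α, hα, rfl⟩ := hA
    induction hK using Submodule.span_induction with
    | mem K hK =>
      obtain ⟨β, hβ, rfl⟩ := hK
      refine Submodule.subset_span ⟨Sum.elim α β, ?_, ?_⟩
      · simp only [Finset.mem_coe, Fintype.mem_piFinset] at hα hβ ⊢
        rintro (i | i)
        · exact hα i
        · exact hβ i
      · ext z w
        simp [pauliString, tensorOp, Fintype.prod_sum_type]
    | zero =>
      convert Submodule.zero_mem _
      ext z w
      simp [tensorOp]
    | add K M _ _ hK hM =>
      convert add_mem hK hM
      ext z w
      simp [tensorOp, mul_add]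
    | smul r K _ hK =>
      convert Submodule.smul_mem _ r hK
      ext z w
      simp [tensorOp, mul_left_comm]
  | zero =>
    convert Submodule.zero_mem _
    ext z w
    simp [tensorOp]
  | add A B _ _ hA hB =>
    convert add_mem hA hB
    ext z w
    simp [tensorOp, add_mul]
  | smul r A _ hA =>
    convert Submodule.smul_mem _ r hA
    ext z w
    simp [tensorOp, mul_assoc]

end PauliTerms

/-! ### Counting the Pauli terms -/

section Count

variable {n k L : ℕ} (U : Fin L → Gate (Fin n) k) (m : ℕ)

/-- The Pauli strings that act on the clock only. -/
def clockTerms (n m : ℕ) : Finset (Fin n ⊕ Fin m → Fin 4) :=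
  Fintype.piFinset (Sum.elim (fun _ => {0}) fun _ => Finset.univ)

/-- The Pauli strings in the propagation term of the gate `U l`. -/
def gateTerms (l : Fin L) : Finset (Fin n ⊕ Fin m → Fin 4) :=
  Fintype.piFinset (Sum.elim (pauliOn (U l).support)
    fun i => pauliOfUnit (timeBits m (l + 1) i) (timeBits m l i))

/-- The Pauli strings in the check of the qubit `i` at time zero. -/
def startTerms (i : Fin n) : Finset (Fin n ⊕ Fin m → Fin 4) :=
  Fintype.piFinset (Sum.elim (pauliOfExcited i)
    fun j => pauliOfUnit (timeBits m 0 j) (timeBits m 0 j))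

/-- The Pauli strings in the check of the qubit `i` at any time. -/
def idleTerms (i : Fin n) : Finset (Fin n ⊕ Fin m → Fin 4) :=
  Fintype.piFinset (Sum.elim (pauliOfExcited i) fun _ => {0})

/-- The Pauli strings in the history Hamiltonian. -/
def historyTerms : Finset (Fin n ⊕ Fin m → Fin 4) :=
  clockTerms n m ∪ Finset.univ.biUnion (gateTerms U m) ∪ (touched U).biUnion (startTerms m) ∪
    Finset.univ.biUnion (idleTerms m)

theorem card_clockTerms : (clockTerms n m).card = 4 ^ m := by
  simp [clockTerms, Fintype.card_piFinset, Fintype.prod_sum_type]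

theorem card_gateTerms_le (l : Fin L) : (gateTerms U m l).card ≤ 4 ^ k * 2 ^ m := by
  rw [gateTerms, Fintype.card_piFinset, Fintype.prod_sum_type]
  simp only [Sum.elim_inl, Sum.elim_inr, card_pauliOfUnit, Finset.prod_const, Finset.card_univ,
    Fintype.card_fin]
  refine Nat.mul_le_mul_right _ ?_
  have h : ∀ i, (pauliOn (U l).support i).card = if i ∈ (U l).support then 4 else 1 := by
    intro i
    rw [pauliOn]
    split_ifs <;> simp
  simp only [h]
  rw [Finset.prod_ite_mem, Finset.univ_inter, Finset.prod_const]
  exact Nat.pow_le_pow_right (by norm_num) (U l).card_le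

theorem prod_card_pauliOfExcited {q : Type} [Fintype q] [DecidableEq q] (i : q) :
    ∏ j, (pauliOfExcited i j).card = 2 := by
  have h : ∀ j, (pauliOfExcited i j).card = if j = i then 2 else 1 := by
    intro j
    rw [pauliOfExcited]
    split_ifs <;> rfl
  simp [h]

theorem card_startTerms (i : Fin n) : (startTerms m i).card = 2 * 2 ^ m := by
  rw [startTerms, Fintype.card_piFinset, Fintype.prod_sum_type]
  simp [card_pauliOfUnit, prod_card_pauliOfExcited]

theorem card_idleTerms (i : Fin n) : (idleTerms m i).card = 2 := by
  rw [idleTerms, Fintype.card_piFinset, Fintype.prod_sum_type]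
  simp [prod_card_pauliOfExcited]

theorem card_historyTerms_le :
    (historyTerms U m).card ≤ 4 ^ m + L * (4 ^ k * 2 ^ m) + L * k * (2 * 2 ^ m) + n * 2 := by
  rw [historyTerms]
  refine (Finset.card_union_le _ _).trans (add_le_add ?_ ?_)
  · refine (Finset.card_union_le _ _).trans (add_le_add ?_ ?_)
    · refine (Finset.card_union_le _ _).trans (add_le_add (card_clockTerms m).le ?_)
      simpa using Finset.card_biUnion_le_card_mul Finset.univ (gateTerms U m) _
        fun l _ => card_gateTerms_le U m l
    · exact (Finset.card_biUnion_le_card_mul _ _ _ fun i _ => (card_startTerms m i).le).trans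
        (Nat.mul_le_mul_right _ (card_touched_le U))
  · simpa using Finset.card_biUnion_le_card_mul Finset.univ (idleTerms m) _
      fun i _ => (card_idleTerms m i).le

theorem tensorOp_one_mem_pauliSpan (c c' : Fin m → Fin 2) :
    tensorOp (1 : Op (Fin n)) (single c c' 1) ∈
      pauliSpan (historyTerms U m : Set (Fin n ⊕ Fin m → Fin 4)) := by
  have h1 : (single c c' 1 : Op (Fin m)) ∈
      pauliSpan ((Fintype.piFinset fun _ => Finset.univ : Finset (Fin m → Fin 4)) :
        Set (Fin m → Fin 4)) := by
    rw [single_eq_productOp]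
    exact productOp_mem_pauliSpan fun i => single_mem_span_pauli_univ _ _
  have h2 : tensorOp (1 : Op (Fin n)) (single c c' 1) ∈
      pauliSpan (clockTerms n m : Set (Fin n ⊕ Fin m → Fin 4)) :=
    tensorOp_mem_pauliSpan (one_mem_pauliSpan fun _ => by simp) h1
  refine pauliSpan_mono (Finset.coe_subset.2 fun α hα => ?_) h2
  simp only [historyTerms, Finset.mem_union]
  exact Or.inl (Or.inl (Or.inl hα))

/-- A padding step carries the identity on the data, so its strings are already among the `4 ^ m`
clock strings; only the `L` genuine gates need strings of their own. -/
theorem tensorOp_gateAt_mem_pauliSpan (t : ℕ) :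
    tensorOp (gateAt U t) (single (timeBits m (t + 1)) (timeBits m t) 1) ∈
      pauliSpan (historyTerms U m : Set (Fin n ⊕ Fin m → Fin 4)) := by
  rw [gateAt]
  split_ifs with h
  · refine pauliSpan_mono (Finset.coe_subset.2 fun α hα => ?_) (tensorOp_mem_pauliSpan
      (Gate.toOp_mem_pauliSpan (U ⟨t, h⟩)) (single_mem_pauliSpan _ _))
    simp only [historyTerms, Finset.mem_union, Finset.mem_biUnion]
    exact Or.inl (Or.inl (Or.inr ⟨⟨t, h⟩, Finset.mem_univ _, hα⟩))
  · exact tensorOp_one_mem_pauliSpan U m _ _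

/-- By unitarity the gate cancels from the diagonal terms, which act on the clock only; it survives
just in one off-diagonal term and its adjoint. -/
theorem propagation_conjTranspose_mul_self (t : ℕ) :
    (propagation U m t)ᴴ * propagation U m t =
      tensorOp 1 (single (timeBits m (t + 1)) (timeBits m (t + 1)) 1)
      - tensorOp (gateAt U t) (single (timeBits m (t + 1)) (timeBits m t) 1)
      - ((tensorOp (gateAt U t) (single (timeBits m (t + 1)) (timeBits m t) 1))ᴴ
      - tensorOp 1 (single (timeBits m t) (timeBits m t) 1)) := by
  rw [propagation, conjTranspose_sub, Matrix.sub_mul, Matrix.mul_sub, Matrix.mul_sub]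
  simp only [tensorOp_conjTranspose, tensorOp_mul, gateAt_isometry, conjTranspose_one,
    conjTranspose_single, star_one, single_mul_single_same, Matrix.one_mul, mul_one]

theorem historyHamiltonian_mem_pauliSpan : historyHamiltonian U m ∈
    pauliSpan (historyTerms U m : Set (Fin n ⊕ Fin m → Fin 4)) := by
  rw [historyHamiltonian]
  refine add_mem (Submodule.smul_mem _ _ (Submodule.sum_mem _ fun t _ => ?_))
    (Submodule.sum_mem _ fun i _ => ?_)
  · rw [propagation_conjTranspose_mul_self]
    exact sub_mem (sub_mem (tensorOp_one_mem_pauliSpan U m _ _) (tensorOp_gateAt_mem_pauliSpan U m t))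
      (sub_mem (conjTranspose_mem_pauliSpan (tensorOp_gateAt_mem_pauliSpan U m t))
        (tensorOp_one_mem_pauliSpan U m _ _))
  · rw [initialCheck]
    split_ifs with h
    · rw [tensorOp_conjTranspose, tensorOp_mul, excited_mul_conjTranspose, conjTranspose_single,
        star_one, single_mul_single_same, mul_one]
      refine pauliSpan_mono (Finset.coe_subset.2 fun α hα => ?_) (tensorOp_mem_pauliSpan
        (excited_mem_pauliSpan i) (single_mem_pauliSpan _ _))
      simp only [historyTerms, Finset.mem_union, Finset.mem_biUnion]
      exact Or.inl (Or.inr ⟨i, h, hα⟩)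
    · rw [tensorOp_conjTranspose, tensorOp_mul, excited_mul_conjTranspose, conjTranspose_one,
        Matrix.one_mul]
      refine pauliSpan_mono (Finset.coe_subset.2 fun α hα => ?_) (tensorOp_mem_pauliSpan
        (excited_mem_pauliSpan i) (one_mem_pauliSpan (S := fun _ : Fin m => {0}) fun _ => by simp))
      simp only [historyTerms, Finset.mem_union, Finset.mem_biUnion]
      exact Or.inr ⟨i, Finset.mem_univ _, hα⟩

end Count

/-! ### The variational circuit prepares the history state -/

section Ansatz

variable {q : Type} [Fintype q]

/-- The product state `⨂ i, f i`. -/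
noncomputable def productKet (f : q → Fin 2 → ℂ) : Ket q := fun z => ∏ i, f i (z i)

theorem ketZero_eq_productKet : (ketZero : Ket q) = productKet fun _ => Pi.single 0 1 := by
  ext z
  simp only [ketZero, productKet, Pi.single_apply, Finset.prod_ite_zero, Finset.mem_univ,
    true_implies, Finset.prod_const_one, funext_iff]

variable [DecidableEq q]

theorem productOp_mulVec_productKet (M : q → Matrix (Fin 2) (Fin 2) ℂ) (f : q → Fin 2 → ℂ) :
    productOp M *ᵥ productKet f = productKet fun i => M i *ᵥ f i := by
  ext z
  simp only [mulVec, dotProduct, productOp, productKet, ← Finset.prod_mul_distrib]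
  rw [Finset.prod_univ_sum, Fintype.piFinset_univ]

/-- The matrix of a rotation of a single qubit. -/
noncomputable def rotationMatrix (θ : ℝ) : Matrix (Fin 2) (Fin 2) ℂ :=
  !![(Real.cos θ : ℂ), -(Real.sin θ : ℂ); (Real.sin θ : ℂ), (Real.cos θ : ℂ)]

theorem rotation_eq_productOp (i : q) (θ : ℝ) :
    rotation i θ = productOp fun j => if j = i then rotationMatrix θ else 1 := by
  ext x y
  rw [productOp, ← Finset.mul_prod_erase _ _ (Finset.mem_univ i), if_pos rfl]
  have h : ∏ j ∈ Finset.univ.erase i,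
      (if j = i then rotationMatrix θ else 1 : Matrix (Fin 2) (Fin 2) ℂ) (x j) (y j)
      = if ∀ j, j ≠ i → x j = y j then 1 else 0 := by
    rw [Finset.prod_congr rfl (g := fun j => if x j = y j then (1 : ℂ) else 0)
      fun j hj => by rw [if_neg (Finset.ne_of_mem_erase hj), one_apply]]
    simp only [Finset.prod_ite_zero, Finset.prod_const_one, Finset.mem_erase, Finset.mem_univ,
      and_true]
  rw [h, rotation, rotationMatrix]
  split_ifs <;> simp

theorem foldl_rotation_productKet (θ : ℝ) (l : List q) (hl : l.Nodup) (f : q → Fin 2 → ℂ) :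
    (l.map fun i => rotation i θ).foldl (fun v M => M *ᵥ v) (productKet f) =
      productKet fun j => if j ∈ l then rotationMatrix θ *ᵥ f j else f j := by
  induction l generalizing f with
  | nil => simp
  | cons i l ih =>
    rw [List.nodup_cons] at hl
    rw [List.map_cons, List.foldl_cons, rotation_eq_productOp, productOp_mulVec_productKet,
      ih hl.2]
    congr 1
    funext j
    by_cases hj : j = i
    · subst hj
      simp [hl.1]
    · simp [hj]

variable {n k L m : ℕ} (U : Fin L → Gate (Fin n) k)

theorem slice_clockControlled_mulVec (r : ℕ) (A : Op (Fin n)) (φ : Ket (Fin n ⊕ Fin m))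
    (c : Fin m → Fin 2) : slice (clockControlled r A *ᵥ φ) c =
      if r < clockTime c then A *ᵥ slice φ c else slice φ c := by
  ext x
  rw [slice, mulVec, dotProduct, sum_register, Finset.sum_eq_single c]
  · have h : ∀ y, clockControlled r A (Sum.elim x c) (Sum.elim y c) =
        if r < clockTime c then A x y else (1 : Op (Fin n)) x y := fun y => if_pos fun _ => rfl
    simp only [h]
    split_ifs
    · rfl
    · exact congrFun (one_mulVec (slice φ c)) x
  · intro c' _ hc
    refine Finset.sum_eq_zero fun y _ => ?_
    rw [clockControlled, if_neg, zero_mul]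
    intro h
    exact hc (funext fun i => (h i).symm)
  · simp

/-- The controls are diagonal in the clock, so each slice evolves alone. With gates counted from
zero, gate `l` fires when `l < clockTime c`, hence the slice at time `t` receives exactly the first
`t` gates. -/
theorem slice_foldl_clockControlled (φ : Ket (Fin n ⊕ Fin m)) (r : ℂ)
    (hφ : ∀ c, slice φ c = r • ketZero) (c : Fin m → Fin 2) {j : ℕ} (hj : j ≤ L) :
    slice ((((List.ofFn fun l : Fin L => clockControlled (l : ℕ) (U l).toOp).take j).foldl
      (fun v M => M *ᵥ v) φ)) c = r • stateAfter U (min j (clockTime c)) := by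
  induction j with
  | zero => simp [hφ, stateAfter_zero]
  | succ j ih =>
    rw [List.take_succ_eq_append_getElem (by simpa using hj), List.foldl_append]
    simp only [List.getElem_ofFn, List.foldl_cons, List.foldl_nil]
    rw [slice_clockControlled_mulVec, ih (by omega)]
    split_ifs with h
    · rw [min_eq_left h.le, min_eq_left (by omega), stateAfter_succ, gateAt, dif_pos (by omega),
        mulVec_smul]
    · rw [min_eq_right (by omega), min_eq_right (by omega)]

/-- At `π / 4` sine and cosine agree, so each clock qubit becomes an equal superposition and every
clock state gets the same amplitude. -/
theorem slice_rotated_ketZero (c : Fin m → Fin 2) :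
    slice (prepare (List.ofFn fun i : Fin m =>
      (rotation (Sum.inr i) (Real.pi / 4) : Op (Fin n ⊕ Fin m)))) c =
      ((1 / Real.sqrt (2 ^ m) : ℝ) : ℂ) • ketZero := by
  have h1 : (List.ofFn fun i : Fin m => (rotation (Sum.inr i) (Real.pi / 4) : Op (Fin n ⊕ Fin m)))
      = ((List.finRange m).map Sum.inr).map fun i => rotation i (Real.pi / 4) := by
    rw [List.map_map, List.ofFn_eq_map]
    rfl
  have h2 : ∀ b, (rotationMatrix (Real.pi / 4) *ᵥ (Pi.single 0 1 : Fin 2 → ℂ)) b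
      = ((Real.sqrt 2 / 2 : ℝ) : ℂ) := by
    intro b
    fin_cases b <;> simp [rotationMatrix]
  have h3 : (Real.sqrt 2 / 2) ^ m = 1 / Real.sqrt (2 ^ m) := by
    rw [Real.sqrt_eq_rpow (2 ^ m), ← Real.rpow_natCast 2 m, ← Real.rpow_mul (by norm_num), mul_comm,
      Real.rpow_mul (by norm_num), ← Real.sqrt_eq_rpow, Real.rpow_natCast, ← _root_.one_div_pow]
    congr 1
    rw [div_eq_div_iff (by norm_num) (by positivity)]
    simp
  rw [prepare, h1, ketZero_eq_productKet, foldl_rotation_productKet _ _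
    ((List.nodup_finRange m).map Sum.inr_injective)]
  ext x
  rw [slice, productKet, Fintype.prod_sum_type, ketZero_eq_productKet, ← h3]
  simp [h2, productKet, mul_comm, _root_.div_pow]

theorem historyState_eq_ansatz (U : Fin L → Gate (Fin n) k) (m : ℕ) :
    ansatz U m 0 (fun _ => Real.pi / 4) = historyState U m 0 := by
  have h : ∀ c, slice (ansatz U m 0 fun _ => Real.pi / 4) c = slice (historyState U m 0) c := by
    intro c
    rw [ansatz, prepare, List.foldl_append]
    have h1 := slice_foldl_clockControlled U _ _ slice_rotated_ketZero c le_rfl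
    rw [List.take_of_length_le (by simp)] at h1
    simp only [zero_add]
    refine h1.trans ?_
    rw [slice_historyState]
    congr 1
    rcases le_total L (clockTime c) with hc | hc
    · rw [min_eq_left hc, stateAfter_of_le U hc, stateAfter_of_le U le_rfl]
    · rw [min_eq_right hc]
  ext z
  have h1 := congrFun (h fun i => z (Sum.inr i)) fun i => z (Sum.inl i)
  simp only [slice] at h1
  have h2 : Sum.elim (fun i => z (Sum.inl i)) (fun i => z (Sum.inr i)) = z := by
    ext (i | i) <;> rfl
  rwa [h2] at h1

end Ansatz

/-! ### Fidelity of the data register with the output -/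

section Fidelity

variable {n k L m : ℕ}

/-- The component of `φ` in which the data register is orthogonal to `χ`. -/
noncomputable def leakage (χ : Ket (Fin n)) (φ : Ket (Fin n ⊕ Fin m)) : Ket (Fin n ⊕ Fin m) :=
  fun z => φ z - (star χ ⬝ᵥ slice φ fun i => z (Sum.inr i)) * χ fun i => z (Sum.inl i)

theorem leakage_add (χ : Ket (Fin n)) (φ ξ : Ket (Fin n ⊕ Fin m)) :
    leakage χ (φ + ξ) = leakage χ φ + leakage χ ξ := by
  ext z
  have h : ∀ c, slice (φ + ξ) c = slice φ c + slice ξ c := fun _ => rfl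
  simp only [leakage, h, dotProduct_add, Pi.add_apply]
  ring

theorem leakage_smul (χ : Ket (Fin n)) (r : ℂ) (φ : Ket (Fin n ⊕ Fin m)) :
    leakage χ (r • φ) = r • leakage χ φ := by
  ext z
  have h : ∀ c, slice (r • φ) c = r • slice φ c := fun _ => rfl
  simp only [leakage, h, dotProduct_smul, Pi.smul_apply, smul_eq_mul]
  ring

theorem ketNormSq_slice_leakage {χ : Ket (Fin n)} (hχ : ketNormSq χ = 1)
    (φ : Ket (Fin n ⊕ Fin m)) (c : Fin m → Fin 2) : ketNormSq (slice (leakage χ φ) c) =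
      ketNormSq (slice φ c) - ‖star χ ⬝ᵥ slice φ c‖ ^ 2 :=
  ketNormSq_sub_proj hχ (slice φ c)

/-- Pythagoras in each slice. Unlike the fidelity, `leakage` is linear in the state, which makes
perturbation estimates easy. -/
theorem dataFidelity_eq {χ : Ket (Fin n)} (hχ : ketNormSq χ = 1) (φ : Ket (Fin n ⊕ Fin m)) :
    dataFidelity χ φ = ketNormSq φ - ketNormSq (leakage χ φ) := by
  rw [ketNormSq_eq_sum_slice φ, ketNormSq_eq_sum_slice (leakage χ φ), ← Finset.sum_sub_distrib]
  refine Finset.sum_congr rfl fun c _ => ?_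
  rw [ketNormSq_slice_leakage hχ, sub_sub_cancel]
  rfl

theorem ketNormSq_leakage_le {χ : Ket (Fin n)} (hχ : ketNormSq χ = 1)
    (φ : Ket (Fin n ⊕ Fin m)) : ketNormSq (leakage χ φ) ≤ ketNormSq φ := by
  rw [ketNormSq_eq_sum_slice φ, ketNormSq_eq_sum_slice (leakage χ φ)]
  refine Finset.sum_le_sum fun c _ => ?_
  rw [ketNormSq_slice_leakage hχ]
  exact sub_le_self _ (sq_nonneg _)

/-- From time `L` on the data register is the output, so only the `L` earlier times leak, each with
weight at most `1 / 2 ^ m`. -/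
theorem ketNormSq_leakage_historyState_le (U : Fin L → Gate (Fin n) k) (hL : L ≤ 2 ^ m) :
    ketNormSq (leakage (output U) (historyState U m 0)) ≤ L / 2 ^ m := by
  have hχ : ketNormSq (output U) = 1 := stateAfter_of_le U le_rfl ▸ ketNormSq_stateAfter U L
  have hn : ∀ t ∈ Finset.range (2 ^ m), ketNormSq (slice (historyState U m 0) (timeBits m t))
      = 1 / 2 ^ m := by
    intro t _
    rw [slice_historyState, ketNormSq_smul, ketNormSq_stateAfter, Complex.norm_real,
      Real.norm_eq_abs, sq_abs, div_pow, Real.sq_sqrt (by positivity), one_pow, mul_one]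
  have h : ∀ t ∈ Finset.range (2 ^ m),
      ketNormSq (slice (leakage (output U) (historyState U m 0)) (timeBits m t))
        ≤ if t ∈ Finset.range L then 1 / 2 ^ m else 0 := by
    intro t ht
    rw [ketNormSq_slice_leakage hχ, hn t ht]
    split_ifs with htL
    · exact sub_le_self _ (sq_nonneg _)
    · rw [slice_historyState, clockTime_timeBits (Finset.mem_range.1 ht),
        stateAfter_of_le U (by simpa using htL), dotProduct_smul, star_dotProduct_self, hχ,
        Complex.ofReal_one, smul_eq_mul, mul_one, Complex.norm_real, Real.norm_eq_abs, sq_abs,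
        div_pow, Real.sq_sqrt (by positivity), one_pow, sub_self]
  rw [ketNormSq_eq_sum_time]
  refine (Finset.sum_le_sum h).trans ?_
  rw [Finset.sum_ite_mem, Finset.inter_eq_right.2 (Finset.range_mono hL), Finset.sum_const,
    Finset.card_range, nsmul_eq_mul, mul_one_div]

/-- A state close to the history state has its data register close to the output. -/
theorem dataFidelity_output_ge (U : Fin L → Gate (Fin n) k) (hL : L ≤ 2 ^ m)
    {φ : Ket (Fin n ⊕ Fin m)} (hφ : IsState φ) :
    1 - 2 * (L / 2 ^ m) - 2 * (1 - ‖star (historyState U m 0) ⬝ᵥ φ‖ ^ 2)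
      ≤ dataFidelity (output U) φ := by
  have hχ : ketNormSq (output U) = 1 := stateAfter_of_le U le_rfl ▸ ketNormSq_stateAfter U L
  set a := star (historyState U m 0) ⬝ᵥ φ with ha
  set ξ := φ - a • historyState U m 0 with hξ
  have h1 : ketNormSq ξ = 1 - ‖a‖ ^ 2 := by
    rw [hξ, ha, ketNormSq_sub_proj (ketNormSq_historyState U), isState_iff.1 hφ]
  have h2 : φ = a • historyState U m 0 + ξ := by rw [hξ]; abel
  have h3 : ketNormSq (leakage (output U) φ) ≤
      2 * (‖a‖ ^ 2 * ketNormSq (leakage (output U) (historyState U m 0))) + 2 * ketNormSq ξ := by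
    have h4 := ketNormSq_add_le (leakage (output U) (a • historyState U m 0))
      (leakage (output U) ξ)
    rw [← leakage_add, ← h2, leakage_smul, ketNormSq_smul] at h4
    linarith [ketNormSq_leakage_le hχ ξ]
  have h5 : ‖a‖ ^ 2 ≤ 1 := by linarith [ketNormSq_nonneg ξ]
  have h6 : ‖a‖ ^ 2 * ketNormSq (leakage (output U) (historyState U m 0)) ≤ L / 2 ^ m :=
    (mul_le_of_le_one_left (ketNormSq_nonneg _) h5).trans (ketNormSq_leakage_historyState_le U hL)
  rw [dataFidelity_eq hχ, isState_iff.1 hφ]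
  linarith

end Fidelity

/-! ### Choice of the clock size and the main theorem -/

/-- A clock with room for `2 ^ K` times as many steps as there are gates. -/
theorem exists_clock_size (K : ℕ) {L : ℕ} (hL : 1 ≤ L) :
    ∃ m : ℕ, 0 < m ∧ L < 2 ^ m ∧ 2 ^ K * L ≤ 2 ^ m ∧ 2 ^ m ≤ 2 ^ (K + 1) * L ∧
      (m : ℝ) ≤ (K + 2) / Real.log 2 * Real.log (L + 1) := by
  have h1 : L < 2 ^ (Nat.log 2 L + 1) := Nat.lt_pow_succ_log_self (by norm_num) L
  have h2 : 2 ^ Nat.log 2 L ≤ L := Nat.pow_log_le_self 2 (by omega)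
  have h3 : 2 ^ (K + (Nat.log 2 L + 1)) ≤ 2 ^ (K + 1) * L := by
    calc 2 ^ (K + (Nat.log 2 L + 1)) = 2 ^ (K + 1) * 2 ^ Nat.log 2 L := by ring
      _ ≤ _ := Nat.mul_le_mul_left _ h2
  refine ⟨K + (Nat.log 2 L + 1), by omega, h1.trans_le (Nat.pow_le_pow_right (by norm_num)
    (by omega)), ?_, h3, ?_⟩
  · rw [pow_add]
    exact Nat.mul_le_mul_left _ h1.le
  · have hlog : 0 < Real.log 2 := Real.log_pos (by norm_num)
    have hL' : (1 : ℝ) ≤ L := by exact_mod_cast hL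
    have h4 : (2 : ℝ) ^ (K + (Nat.log 2 L + 1)) ≤ 2 ^ (K + 1) * L := by exact_mod_cast h3
    have h5 := Real.log_le_log (by positivity) h4
    rw [Real.log_mul (by positivity) (by positivity), Real.log_pow, Real.log_pow] at h5
    -- Since `1 ≤ L`, the constant part of `m` is also absorbed into a multiple of `log (L + 1)`.
    have h6 : Real.log 2 ≤ Real.log (L + 1) := Real.log_le_log (by norm_num) (by linarith)
    have h7 : Real.log L ≤ Real.log (L + 1) := Real.log_le_log (by linarith) (by linarith)
    rw [div_mul_eq_mul_div, le_div_iff₀ hlog]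
    push_cast at h5 ⊢
    nlinarith [mul_le_mul_of_nonneg_left h6 (by positivity : (0 : ℝ) ≤ K + 1)]

end VQC

theorem theorem2 (k : ℕ) (ε : ℝ) (hε : 0 < ε) :
    ∃ C c : ℝ, 0 < C ∧ 0 < c ∧
      ∀ (n L : ℕ), 1 ≤ L → ∀ U : Fin L → VQC.Gate (Fin n) k,
        ∃ (m s : ℕ) (J : (Fin n ⊕ Fin m → Fin 4) → ℝ) (Δ δ : ℝ),
          -- the number of clock qubits, and the padding, which leaves room for all the gates
          (m : ℝ) ≤ C * Real.log (L + 1) ∧ s + L < 2 ^ m ∧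
          -- the number of Pauli terms
          (VQC.cardinality J : ℝ) ≤ C * ((L : ℝ) ^ 2 + n) ∧
          -- the ground state, with energy zero, and the energy scale
          VQC.IsNondegenerateGroundState (VQC.hamiltonian J) 0 (VQC.historyState U m s) ∧
          (∀ e ∈ VQC.energyLevels (VQC.hamiltonian J), e ≤ C * (n + 1)) ∧
          -- the spectral gap and the threshold of acceptance
          VQC.IsSpectralGap (VQC.hamiltonian J) Δ ∧
          c / (L : ℝ) ^ 2 ≤ δ ∧ δ ≤ Δ ∧
          -- stability: energy below the gap bounds the overlap with the ground state
          (∀ φ, VQC.IsState φ → VQC.Accepts (VQC.hamiltonian J) Δ φ →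
            1 - VQC.energy (VQC.hamiltonian J) φ / Δ ≤
              ‖star (VQC.historyState U m s) ⬝ᵥ φ‖ ^ 2) ∧
          -- acceptance implies preparation of the output of the circuit
          (∀ φ, VQC.IsState φ → VQC.Accepts (VQC.hamiltonian J) δ φ →
            1 - ε ≤ VQC.dataFidelity (VQC.output U) φ) ∧
          -- the gate sequence gives an accepted variational sequence
          VQC.historyState U m s ∈ VQC.variationalStatespace (VQC.ansatz U m s) ∧
          VQC.Accepts (VQC.hamiltonian J) δ (VQC.historyState U m s) := by
  -- This makes `L / 2 ^ m` at most `ε / 4`.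
  obtain ⟨K, hK⟩ := pow_unbounded_of_one_lt (4 / ε) (one_lt_two (α := ℝ))
  set R : ℝ := 2 ^ (K + 1) with hR
  have hR0 : 0 < R := by positivity
  have hlog : 0 < Real.log 2 := Real.log_pos (by norm_num)
  -- The ratio of threshold to gap: `ε / 4` leaves room for the factor two in the fidelity bound,
  -- and the cap `1` keeps the threshold below the gap.
  set η : ℝ := min (ε / 4) 1 with hη
  have hη0 : 0 < η := lt_min (by positivity) one_pos
  set C₁ : ℝ := (K + 2) / Real.log 2 with hC₁
  have hC₁0 : 0 ≤ C₁ := by positivity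
  -- Coefficients of `L ^ 2` from the clock strings, the gates and the start checks, using `2 ^ m ≤
  -- R * L`.
  set C₂ : ℝ := R ^ 2 + 4 ^ k * R + 2 * k * R with hC₂
  have hC₂0 : 0 ≤ C₂ := by positivity
  -- The summand `2` covers the two strings of each idle check and the `n + 2` in the energy bound.
  refine ⟨C₁ + C₂ + 2, η / (4 * R ^ 2), by positivity, by positivity, fun n L hL U => ?_⟩
  obtain ⟨m, hm, hLm, hKm, hRm, hmC⟩ := VQC.exists_clock_size K hL
  have hL1 : (1 : ℝ) ≤ L := by exact_mod_cast hL
  have hL0 : (0 : ℝ) < L := by linarith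
  have hN0 : (0 : ℝ) < 2 ^ m := by positivity
  have hN : (2 : ℝ) ^ m ≤ R * L := by rw [hR]; exact_mod_cast hRm
  have hψ : VQC.IsState (VQC.historyState U m 0) :=
    VQC.isState_iff.2 (VQC.ketNormSq_historyState U)
  have hHψ := VQC.historyHamiltonian_mulVec_historyState U (m := m)
  have hH := VQC.historyHamiltonian_isHermitian U m
  have hground := VQC.isNondegenerateGroundState_of_gap hψ hHψ (by positivity)
    (VQC.energy_historyHamiltonian_ge U) (VQC.energy_historyHamiltonian_nonneg U m)
  -- The data register may be empty, so the nonempty clock ensures that a second energy level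
  -- exists.
  have : Nonempty (Fin n ⊕ Fin m) := ⟨Sum.inr ⟨0, hm⟩⟩
  obtain ⟨Δ, hΔ, hgΔ, hstab⟩ := VQC.exists_isSpectralGap hH hHψ hground
    (VQC.energy_historyHamiltonian_ge U)
  obtain ⟨J, hJ, hcard⟩ := VQC.exists_hamiltonian_eq hH (VQC.historyHamiltonian_mem_pauliSpan U m)
  have hΔ0 : 0 < Δ := lt_of_lt_of_le (by positivity) hgΔ
  have hηΔ : η * Δ ≤ Δ := mul_le_of_le_one_left hΔ0.le (min_le_right _ _)
  refine ⟨m, 0, J, Δ, η * Δ, ?_, by simpa using hLm, ?_, ?_⟩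
  · refine hmC.trans (mul_le_mul_of_nonneg_right (by linarith) (Real.log_nonneg (by linarith)))
  · have h1 : (VQC.cardinality J : ℝ) ≤
        4 ^ m + L * (4 ^ k * 2 ^ m) + L * k * (2 * 2 ^ m) + n * 2 := by
      exact_mod_cast hcard.trans (VQC.card_historyTerms_le U m)
    have h2 : (4 : ℝ) ^ m = (2 ^ m) ^ 2 := by
      rw [← pow_mul, mul_comm, pow_mul]
      norm_num
    have h3 : ((2 : ℝ) ^ m) ^ 2 ≤ (R * L) ^ 2 := pow_le_pow_left₀ hN0.le hN 2
    have h4 : (L : ℝ) * (4 ^ k * 2 ^ m) ≤ L * (4 ^ k * (R * L)) := by gcongr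
    have h5 : (L : ℝ) * k * (2 * 2 ^ m) ≤ L * k * (2 * (R * L)) := by gcongr
    have h6 : 0 ≤ (C₁ + 2) * (L : ℝ) ^ 2 := by positivity
    have h7 : 0 ≤ (C₁ + C₂) * (n : ℝ) := by positivity
    rw [h2] at h1
    rw [hC₂] at h7 ⊢
    linarith
  · rw [hJ]
    refine ⟨hground, fun e he => ?_, hΔ, ?_, hηΔ, fun φ hφ _ => ?_, fun φ hφ hacc => ?_,
      ⟨_, VQC.historyState_eq_ansatz U m⟩, ?_⟩
    · obtain ⟨φ, hφ, h⟩ := VQC.mem_energyLevels.1 he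
      have h1 := VQC.energy_historyHamiltonian_le U φ
      rw [VQC.energy_of_eigenvector h] at h1
      have h2 : 0 < VQC.ketNormSq φ :=
        (VQC.ketNormSq_nonneg φ).lt_of_ne fun h => hφ (VQC.ketNormSq_eq_zero.1 h.symm)
      have h3 := le_of_mul_le_mul_right h1 h2
      have h4 : 0 ≤ (C₁ + C₂) * ((n : ℝ) + 1) := by positivity
      have h5 : (0 : ℝ) ≤ n := Nat.cast_nonneg n
      linarith
    · have h1 : 1 / (4 * R ^ 2) / (L : ℝ) ^ 2 ≤ Δ := by
        refine le_trans ?_ hgΔ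
        rw [div_div]
        refine one_div_le_one_div_of_le (by positivity) ?_
        have h3 : ((2 : ℝ) ^ m) ^ 2 ≤ (R * L) ^ 2 := pow_le_pow_left₀ hN0.le hN 2
        linarith
      calc η / (4 * R ^ 2) / (L : ℝ) ^ 2 = η * (1 / (4 * R ^ 2) / (L : ℝ) ^ 2) := by ring
        _ ≤ η * Δ := mul_le_mul_of_nonneg_left h1 hη0.le
    · have h1 : 1 - ‖star (VQC.historyState U m 0) ⬝ᵥ φ‖ ^ 2
          ≤ VQC.energy (VQC.historyHamiltonian U m) φ / Δ := by
        rw [le_div_iff₀ hΔ0, mul_comm]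
        exact hstab φ hφ
      linarith
    · have h1 : 1 - ‖star (VQC.historyState U m 0) ⬝ᵥ φ‖ ^ 2 < η := by
        refine lt_of_mul_lt_mul_left ((hstab φ hφ).trans_lt ?_) hΔ0.le
        rwa [mul_comm]
      have h2 : (L : ℝ) / 2 ^ m ≤ ε / 4 := by
        have h3 : (2 : ℝ) ^ K * L ≤ 2 ^ m := by exact_mod_cast hKm
        rw [div_lt_iff₀ hε] at hK
        rw [div_le_iff₀ hN0]
        nlinarith
      have h4 := VQC.dataFidelity_output_ge U hLm.le hφ
      have h5 : η ≤ ε / 4 := min_le_left _ _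
      linarith
    · rw [VQC.Accepts, VQC.energy, hHψ]
      simpa using mul_pos hη0 hΔ0
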